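/- Let $A\in\mathbb R^{n\times n}$, $B\in\mathbb R^{n\times m}$, $C\in\mathbb R^{n\times p}$, let $d\in\mathbb R^p$ be a constant disturbance, let $Q\in\mathbb R^{n\times n}$ be (symmetric) positive semidefinite and let $R\in\mathbb R^{m\times m}$, $K^y,K^\lambda\in\mathbb R^{n\times n}$ be (symmetric) positive definite. Assume that $(A,B)$ is stabilizable, that $(A,Q)$ is detectable, and that the primal-dual matrix $$S=\begin{bmatrix}K^y&0\\0&K^\lambda\end{bmatrix}\begin{bmatrix}-Q&-A^T\\A&-BR^{-1}B^T\end{bmatrix}$$ is Hurwitz (all its eigenvalues have negative real part). Then: 1. The algebraic Riccati equation $PA+A^TP-PBR^{-1}B^TP+Q=0$ has a unique positive semidefinite solution $P^*$; put $K=R^{-1}B^TP^*$. 2. The steady-state problem of minimizing $\tfrac12(y^TQy+u^TRu)$ subject to $Ay+Bu+Cd=0$ has a unique optimal solution $(\bar x,\bar u)$, and there is a unique Lagrange multiplier $\bar\lambda\in\mathbb R^n$ with $Q\bar x+A^T\bar\lambda=0$, $R\bar u+B^T\bar\lambda=0$, $A\bar x+B\bar u+Cd=0$. 3. The closed loop of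 the plant $\dot x=Ax+Bu+Cd$, the primal-dual dynamics and the near-optimal controller, $$\dot x=Ax+Bu+Cd,\qquad \dot y=-K^y(Qy+A^T\lambda),\qquad \dot\lambda=K^\lambda(Ay-BR^{-1}B^T\lambda+Cd),\qquad u=-K(x-y)-R^{-1}B^T\lambda,$$ is (globally) asymptotically stable, that is, every initial state is the start of a solution on $[0,\infty)$, its equilibrium is stable in the sense of Lyapunov, and every solution on $[0,\infty)$ converges to it. Its unique equilibrium is $(x,y,\lambda)=(\bar x,\bar x,\bar\lambda)$, and the input at this equilibrium is $\bar u$, so that the equilibrium is the optimal steady state. 4. The same holds for the disturbance-independent realization of the controller obtained from the substitution $\mu=\lambda-K^\lambda x$, $$\dot x=Ax+Bu+Cd,\quad \dot y=-K^y\bigl(Qy+A^T(\mu+K^\lambda x)\bigr),\quad \dot\mu=-K^\lambda(A-BK)(x-y),\quad u=-K(x-y)-R^{-1}B^T(\mu+K^\lambda x):$$ this closed loop is (globally) asymptotically stable with unique equilibrium $(x,y,\mu)=(\bar x,\bar x,\bar\lambda-K^\lambda\bar x)$. -/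

import Mathlib

open Matrix Set Filter Topology MeasureTheory

noncomputable section

/-! ### Linear systems theory -/

/-- A real square matrix is Hurwitz if all its (complex) eigenvalues have negative real part. -/
def IsHurwitz {ι : Type*} [Fintype ι] [DecidableEq ι] (M : Matrix ι ι ℝ) : Prop :=
  ∀ μ : ℂ, Module.End.HasEigenvalue (Matrix.toLin' (M.map (fun a : ℝ => (a : ℂ)))) μ → μ.re < 0

/-- The controllable subspace of `ẋ = A x + B u`: the states that some input steers to the origin
in some finite time. -/
def controllableSubspace {n m : ℕ} (A : Matrix (Fin n) (Fin n) ℝ) (B : Matrix (Fin n) (Fin m) ℝ) :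
    Set (Fin n → ℝ) :=
  {x | ∃ t : ℝ, 0 < t ∧ ∃ u : ℝ → Fin m → ℝ, IntervalIntegrable u volume 0 t ∧
    NormedSpace.exp (t • A) *ᵥ x +
      (∫ τ in (0 : ℝ)..t, NormedSpace.exp ((t - τ) • A) *ᵥ (B *ᵥ u τ)) = 0}

/-- `(A, B)` is controllable if its controllable subspace is the whole state space. -/
def IsControllable {n m : ℕ} (A : Matrix (Fin n) (Fin n) ℝ) (B : Matrix (Fin n) (Fin m) ℝ) : Prop :=
  controllableSubspace A B = univ

/-- `(A, B)` is stabilizable: a nonsingular change of coordinates `T` brings it to the form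
`T⁻¹ A T = [A_c, A_12; 0, A_u]`, `T⁻¹ B = [B_c; 0]` with `(A_c, B_c)` controllable and `A_u`
Hurwitz. (`Tinv` is the inverse of `T`; either block may be empty.) -/
def IsStabilizable {n m : ℕ} (A : Matrix (Fin n) (Fin n) ℝ) (B : Matrix (Fin n) (Fin m) ℝ) : Prop :=
  ∃ (r s : ℕ) (T : Matrix (Fin n) (Fin r ⊕ Fin s) ℝ) (Tinv : Matrix (Fin r ⊕ Fin s) (Fin n) ℝ)
    (Ac : Matrix (Fin r) (Fin r) ℝ) (A12 : Matrix (Fin r) (Fin s) ℝ)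
    (Au : Matrix (Fin s) (Fin s) ℝ) (Bc : Matrix (Fin r) (Fin m) ℝ),
    T * Tinv = 1 ∧ Tinv * T = 1 ∧
    Tinv * A * T = Matrix.fromBlocks Ac A12 0 Au ∧
    Tinv * B = Matrix.fromRows Bc 0 ∧
    IsControllable Ac Bc ∧ IsHurwitz Au

/-- `(A, C)` is detectable if `(Aᵀ, Cᵀ)` is stabilizable. -/
def IsDetectable {n q : ℕ} (A : Matrix (Fin n) (Fin n) ℝ) (C : Matrix (Fin q) (Fin n) ℝ) : Prop :=
  IsStabilizable Aᵀ Cᵀ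

/-! ### Stability of autonomous differential equations -/

/-- `z` solves `ż = f z` on `[0, ∞)`. -/
def IsSolution {E : Type*} [NormedAddCommGroup E] [NormedSpace ℝ E] (f : E → E) (z : ℝ → E) : Prop :=
  IsIntegralCurveOn z (fun _ => f) (Ici 0)

/-- `e` is a globally asymptotically stable equilibrium of `ż = f z`: it is an equilibrium, every
initial state is the start of a solution on `[0, ∞)`, `e` is stable in the sense of Lyapunov, and
every solution converges to `e`. -/
structure IsAsymptoticallyStable {E : Type*} [NormedAddCommGroup E] [NormedSpace ℝ E]
    (f : E → E) (e : E) : Prop where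
  equilibrium : f e = 0
  exists_solution : ∀ z₀ : E, ∃ z : ℝ → E, z 0 = z₀ ∧ IsSolution f z
  stable : ∀ ε > 0, ∃ δ > 0, ∀ z : ℝ → E, IsSolution f z → ‖z 0 - e‖ < δ →
    ∀ t : ℝ, 0 ≤ t → ‖z t - e‖ < ε
  attractive : ∀ z : ℝ → E, IsSolution f z → Tendsto z atTop (𝓝 e)

/-! ### Steady-state optimization, the Riccati equation and the controllers -/

section LQ

variable {n m p : ℕ}

/-- The right-hand side `A x + B u + C d` of the plant. -/
def plant (A : Matrix (Fin n) (Fin n) ℝ) (B : Matrix (Fin n) (Fin m) ℝ)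
    (C : Matrix (Fin n) (Fin p) ℝ) (d : Fin p → ℝ) (x : Fin n → ℝ) (u : Fin m → ℝ) : Fin n → ℝ :=
  A *ᵥ x + B *ᵥ u + C *ᵥ d

/-- The cost `f(y, u) = (yᵀ Q y + uᵀ R u) / 2`. -/
def cost (Q : Matrix (Fin n) (Fin n) ℝ) (R : Matrix (Fin m) (Fin m) ℝ)
    (y : Fin n → ℝ) (u : Fin m → ℝ) : ℝ :=
  (1 / 2 : ℝ) * (y ⬝ᵥ Q *ᵥ y + u ⬝ᵥ R *ᵥ u)

/-- `w = (y, u)` minimizes the cost subject to the steady-state constraint `A y + B u + C d = 0`. -/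
def IsOptimalSteadyState (A : Matrix (Fin n) (Fin n) ℝ) (B : Matrix (Fin n) (Fin m) ℝ)
    (C : Matrix (Fin n) (Fin p) ℝ) (Q : Matrix (Fin n) (Fin n) ℝ) (R : Matrix (Fin m) (Fin m) ℝ)
    (d : Fin p → ℝ) (w : (Fin n → ℝ) × (Fin m → ℝ)) : Prop :=
  plant A B C d w.1 w.2 = 0 ∧
    ∀ (y : Fin n → ℝ) (u : Fin m → ℝ), plant A B C d y u = 0 → cost Q R w.1 w.2 ≤ cost Q R y u

/-- `l` is a Lagrange multiplier for `(y, u)`: the KKT conditions hold. -/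
def IsMultiplier (A : Matrix (Fin n) (Fin n) ℝ) (B : Matrix (Fin n) (Fin m) ℝ)
    (C : Matrix (Fin n) (Fin p) ℝ) (Q : Matrix (Fin n) (Fin n) ℝ) (R : Matrix (Fin m) (Fin m) ℝ)
    (d : Fin p → ℝ) (y : Fin n → ℝ) (u : Fin m → ℝ) (l : Fin n → ℝ) : Prop :=
  Q *ᵥ y + Aᵀ *ᵥ l = 0 ∧ R *ᵥ u + Bᵀ *ᵥ l = 0 ∧ plant A B C d y u = 0

/-- `P` is a positive semidefinite solution of `P A + Aᵀ P - P B R⁻¹ Bᵀ P + Q = 0`. -/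
def IsRiccatiSolution (A : Matrix (Fin n) (Fin n) ℝ) (B : Matrix (Fin n) (Fin m) ℝ)
    (Q : Matrix (Fin n) (Fin n) ℝ) (R : Matrix (Fin m) (Fin m) ℝ)
    (P : Matrix (Fin n) (Fin n) ℝ) : Prop :=
  P.PosSemidef ∧ P * A + Aᵀ * P - P * B * R⁻¹ * Bᵀ * P + Q = 0

/-- The feedback gain `K = R⁻¹ Bᵀ P`. -/
def feedbackGain (B : Matrix (Fin n) (Fin m) ℝ) (R : Matrix (Fin m) (Fin m) ℝ)
    (P : Matrix (Fin n) (Fin n) ℝ) : Matrix (Fin m) (Fin n) ℝ :=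
  R⁻¹ * Bᵀ * P

/-- The primal-dual matrix `S = K^S T` with `K^S = [K^y, 0; 0, K^λ]` and
`T = [-Q, -Aᵀ; A, -B R⁻¹ Bᵀ]`. -/
def primalDualMatrix (A : Matrix (Fin n) (Fin n) ℝ) (B : Matrix (Fin n) (Fin m) ℝ)
    (Q : Matrix (Fin n) (Fin n) ℝ) (R : Matrix (Fin m) (Fin m) ℝ)
    (Ky Kl : Matrix (Fin n) (Fin n) ℝ) : Matrix (Fin n ⊕ Fin n) (Fin n ⊕ Fin n) ℝ :=
  Matrix.fromBlocks Ky 0 0 Kl * Matrix.fromBlocks (-Q) (-Aᵀ) A (-(B * R⁻¹ * Bᵀ))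

/-- The near-optimal input `u = -K (x - y) - R⁻¹ Bᵀ λ`. -/
def nearOptimalInput (B : Matrix (Fin n) (Fin m) ℝ) (R : Matrix (Fin m) (Fin m) ℝ)
    (K : Matrix (Fin m) (Fin n) ℝ) (x y l : Fin n → ℝ) : Fin m → ℝ :=
  -(K *ᵥ (x - y)) - (R⁻¹ * Bᵀ) *ᵥ l

/-- The closed loop of the plant, the primal-dual dynamics and the near-optimal input, as a vector
field on triples `(x, y, λ)`. -/
def closedLoop (A : Matrix (Fin n) (Fin n) ℝ) (B : Matrix (Fin n) (Fin m) ℝ)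
    (C : Matrix (Fin n) (Fin p) ℝ) (Q : Matrix (Fin n) (Fin n) ℝ) (R : Matrix (Fin m) (Fin m) ℝ)
    (Ky Kl : Matrix (Fin n) (Fin n) ℝ) (K : Matrix (Fin m) (Fin n) ℝ) (d : Fin p → ℝ) :
    (Fin n → ℝ) × (Fin n → ℝ) × (Fin n → ℝ) → (Fin n → ℝ) × (Fin n → ℝ) × (Fin n → ℝ) :=
  fun z => match z with
  | (x, y, l) =>
    (plant A B C d x (nearOptimalInput B R K x y l),
      -(Ky *ᵥ (Q *ᵥ y + Aᵀ *ᵥ l)),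
      Kl *ᵥ (A *ᵥ y - (B * R⁻¹ * Bᵀ) *ᵥ l + C *ᵥ d))

/-- The controller dynamics `(ẏ, μ̇)` in the variable `μ = λ - K^λ x`; the disturbance does not
occur in it. -/
def implementableController (A : Matrix (Fin n) (Fin n) ℝ) (B : Matrix (Fin n) (Fin m) ℝ)
    (Q : Matrix (Fin n) (Fin n) ℝ) (Ky Kl : Matrix (Fin n) (Fin n) ℝ)
    (K : Matrix (Fin m) (Fin n) ℝ) (x y μ : Fin n → ℝ) : (Fin n → ℝ) × (Fin n → ℝ) :=
  (-(Ky *ᵥ (Q *ᵥ y + Aᵀ *ᵥ (μ + Kl *ᵥ x))),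
    -(Kl *ᵥ ((A - B * K) *ᵥ (x - y))))

/-- The closed loop of the plant and the implementable controller with input
`u = -K (x - y) - R⁻¹ Bᵀ (μ + K^λ x)`, as a vector field on triples `(x, y, μ)`. -/
def implementableClosedLoop (A : Matrix (Fin n) (Fin n) ℝ) (B : Matrix (Fin n) (Fin m) ℝ)
    (C : Matrix (Fin n) (Fin p) ℝ) (Q : Matrix (Fin n) (Fin n) ℝ) (R : Matrix (Fin m) (Fin m) ℝ)
    (Ky Kl : Matrix (Fin n) (Fin n) ℝ) (K : Matrix (Fin m) (Fin n) ℝ) (d : Fin p → ℝ) :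
    (Fin n → ℝ) × (Fin n → ℝ) × (Fin n → ℝ) → (Fin n → ℝ) × (Fin n → ℝ) × (Fin n → ℝ) :=
  fun z => match z with
  | (x, y, μ) =>
    (plant A B C d x (nearOptimalInput B R K x y (μ + Kl *ᵥ x)),
      implementableController A B Q Ky Kl K x y μ)

end LQ

end

/-! ### Linear flows -/

section Flow

variable {E F : Type*} [NormedAddCommGroup E] [NormedSpace ℝ E] [CompleteSpace E]
  [NormedAddCommGroup F] [NormedSpace ℝ F] [CompleteSpace F]

/-! Everything rests on the stable subspace of a linear flow, the vectors whose forward orbit tends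
to zero. In finite dimensions a generalized eigenvector for `μ` has orbit `exp (t μ)` times a
polynomial in `t`, so the spectrum controls this subspace
(`stableSubspace_sup_stableSubspace_neg_eq_top`, `stableSubspace_restrictScalars_eq_top`). Real maps
are treated through their complexifications.

Riccati equation. Put `G = B R⁻¹ Bᵀ` and let `V` be the stable subspace of the Hamiltonian map `(x,
l) ↦ (A x - G l, -Q x - Aᵀ l)`. Stabilizability and detectability, used through the eigenvector
(PBH) test, exclude imaginary eigenvalues, so forward and backward stable subspaces together span.
Both are isotropic for the symplectic form, which the flow preserves, and `V` contains no `(0, l)`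
with `l ≠ 0`. Hence `V` is the graph of a matrix `P`. Isotropy makes `P` symmetric, the decrease of
`x ⬝ l` to zero along orbits makes it positive semidefinite, and invariance of `V` is the Riccati
equation. Conversely, detectability makes `A - B K` Hurwitz for every positive semidefinite
solution, so the graph of each solution lies in `V`; this gives uniqueness.

Steady state. Since `0` is not an eigenvalue of `S`, the KKT system is uniquely solvable
(`eq_zero_of_kkt`, `exists_kkt`), and convexity of the cost turns its solution into the optimum.

Closed loops. The deviation from `(xbar, xbar, lbar)` obeys a block triangular linear equation with
diagonal blocks `S` and `A - B K`, so all orbits tend to zero. Uniform boundedness then yields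
Lyapunov stability (`isAsymptoticallyStable_of_stableSubspace_eq_top`). The variable `μ` is a linear
change of coordinates. -/

theorem hasDerivAt_flow (L : E →L[ℝ] E) (v : E) (t : ℝ) :
    HasDerivAt (fun s : ℝ => NormedSpace.exp (s • L) v) (L (NormedSpace.exp (t • L) v)) t := by
  have h := hasDerivAt_exp_smul_const' (𝕂 := ℝ) L t
  simpa using h.clm_apply (hasDerivAt_const t v)

/-- Solutions of a linear differential equation on `[0, ∞)` are given by the exponential. -/
theorem eq_flow_of_isSolution {L : E →L[ℝ] E} {z : ℝ → E} (hz : IsSolution L z) {t : ℝ}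
    (ht : 0 ≤ t) : z t = NormedSpace.exp (t • L) (z 0) := by
  have hflow := fun s => hasDerivAt_flow L (z 0) s
  refine ODE_solution_unique_of_mem_Icc_right (v := fun _ => L) (s := fun _ => univ)
    (K := ‖L‖₊) (a := 0) (b := t) (f := z) (g := fun s => NormedSpace.exp (s • L) (z 0)) (fun _ _ => L.lipschitz.lipschitzOnWith)
    ?_ ?_ (fun _ _ => mem_univ _) ?_ ?_ (fun _ _ => mem_univ _) ?_ ⟨ht, le_rfl⟩
  · exact fun s hs => ((hz s hs.1).continuousWithinAt).mono Icc_subset_Ici_self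
  · exact fun s hs => (hz s hs.1).mono (Ici_subset_Ici.2 hs.1)
  · exact fun s _ => (hflow s).continuousAt.continuousWithinAt
  · exact fun s _ => (hflow s).hasDerivWithinAt
  · simp

/-- A linear map intertwining two linear vector fields intertwines their flows. -/
theorem map_flow {ι : E →L[ℝ] F} {L : E →L[ℝ] E} {T : F →L[ℝ] F} (h : ∀ v, ι (L v) = T (ι v))
    (v : E) {t : ℝ} (ht : 0 ≤ t) :
    ι (NormedSpace.exp (t • L) v) = NormedSpace.exp (t • T) (ι v) := by
  have hs : IsSolution T (fun s => ι (NormedSpace.exp (s • L) v)) := fun s _ => by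
    have := ι.hasFDerivAt.comp_hasDerivAt s (hasDerivAt_flow L v s)
    rw [h] at this
    exact this.hasDerivWithinAt
  simpa using eq_flow_of_isSolution hs ht

/-- The vectors whose forward orbit under the flow of `L` tends to zero. -/
def stableSubspace (L : E →L[ℝ] E) : Submodule ℝ E where
  carrier := {v | Tendsto (fun t : ℝ => NormedSpace.exp (t • L) v) atTop (𝓝 0)}
  add_mem' := fun ha hb => by simpa using Tendsto.add ha hb
  zero_mem' := by simp
  smul_mem' := fun c _ hx => by simpa using Tendsto.const_smul hx c

omit [CompleteSpace E] in
theorem mem_stableSubspace {L : E →L[ℝ] E} {v : E} : v ∈ stableSubspace L ↔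
    Tendsto (fun t : ℝ => NormedSpace.exp (t • L) v) atTop (𝓝 0) := Iff.rfl

theorem map_mem_stableSubspace {ι : E →L[ℝ] F} {L : E →L[ℝ] E} {T : F →L[ℝ] F}
    (h : ∀ v, ι (L v) = T (ι v)) {v : E} (hv : v ∈ stableSubspace L) :
    ι v ∈ stableSubspace T := by
  have h1 := (ι.continuous.tendsto 0).comp (mem_stableSubspace.1 hv)
  rw [map_zero] at h1
  refine h1.congr' ?_
  filter_upwards [eventually_ge_atTop 0] with t ht using map_flow h v ht

theorem apply_mem_stableSubspace {L : E →L[ℝ] E} {v : E} (hv : v ∈ stableSubspace L) :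
    L v ∈ stableSubspace L :=
  map_mem_stableSubspace (ι := L) (fun _ => rfl) hv

omit [CompleteSpace E] in
theorem isSolution_sub {L : E →L[ℝ] E} {f : E → E} {e : E} (hf : ∀ z, f z = L (z - e))
    {z : ℝ → E} (hz : IsSolution f z) : IsSolution L (fun t => z t - e) := fun t ht => by
  have h := (hz t ht).sub_const e
  change HasDerivWithinAt _ (f (z t)) _ _ at h
  rwa [hf] at h

/-- A linear flow all of whose orbits tend to zero gives a globally asymptotically stable
equilibrium. -/
theorem isAsymptoticallyStable_of_stableSubspace_eq_top {L : E →L[ℝ] E}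
    (hL : stableSubspace L = ⊤) {f : E → E} {e : E} (hf : ∀ z, f z = L (z - e)) :
    IsAsymptoticallyStable f e where
  equilibrium := by simp [hf]
  exists_solution := fun z₀ => by
    refine ⟨fun t => NormedSpace.exp (t • L) (z₀ - e) + e, by simp, fun t _ => ?_⟩
    have := ((hasDerivAt_flow L (z₀ - e) t).add_const e).hasDerivWithinAt (s := Ici 0)
    simpa [hf] using this
  stable := by
    -- Each orbit is continuous and tends to zero, hence is bounded on `[0, ∞)`; Banach–Steinhaus
    -- makes the bound uniform over the unit ball.
    have hb : ∀ v : E, ∃ M, ∀ t : Ici (0 : ℝ), ‖NormedSpace.exp ((t : ℝ) • L) v‖ ≤ M := by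
      intro v
      have hv : v ∈ stableSubspace L := hL ▸ Submodule.mem_top
      have h0 := (mem_stableSubspace.1 hv).norm
      rw [norm_zero] at h0
      obtain ⟨t₀, ht₀⟩ := eventually_atTop.1 (h0.eventually_le_const one_pos)
      have hc : Continuous fun t : ℝ => NormedSpace.exp (t • L) v :=
        continuous_iff_continuousAt.2 fun t => (hasDerivAt_flow L v t).continuousAt
      obtain ⟨M, hM⟩ := (isCompact_Icc (a := (0 : ℝ)) (b := t₀)).exists_bound_of_continuousOn
        hc.continuousOn
      refine ⟨max M 1, fun t => ?_⟩
      rcases le_total (t : ℝ) t₀ with h | h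
      · exact (hM t ⟨t.2, h⟩).trans (le_max_left _ _)
      · exact (ht₀ t h).trans (le_max_right _ _)
    obtain ⟨M, hM⟩ := banach_steinhaus hb
    intro ε hε
    -- `M` can be zero when `E` is trivial, so a positive bound is used for the division.
    have hM1 : 0 < |M| + 1 := by positivity
    refine ⟨ε / (|M| + 1), by positivity, fun z hz h0 t ht => ?_⟩
    rw [eq_flow_of_isSolution (isSolution_sub hf hz) ht]
    have hle : ‖NormedSpace.exp (t • L)‖ ≤ |M| + 1 :=
      (hM ⟨t, ht⟩).trans ((le_abs_self M).trans (by linarith))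
    calc _ ≤ ‖NormedSpace.exp (t • L)‖ * ‖z 0 - e‖ := ContinuousLinearMap.le_opNorm _ _
      _ ≤ (|M| + 1) * ‖z 0 - e‖ := by gcongr
      _ < (|M| + 1) * (ε / (|M| + 1)) := by gcongr
      _ = ε := by field_simp
  attractive := fun z hz => by
    have hv : z 0 - e ∈ stableSubspace L := hL ▸ Submodule.mem_top
    have h1 : Tendsto (fun t => z t - e) atTop (𝓝 0) := by
      refine (mem_stableSubspace.1 hv).congr' ?_
      filter_upwards [eventually_ge_atTop 0] with t ht
      exact (eq_flow_of_isSolution (isSolution_sub hf hz) ht).symm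
    simpa using h1.add_const e

end Flow

/-! ### The spectrum and the stable subspace -/

section Spectrum

variable {E F : Type*} [NormedAddCommGroup E] [NormedSpace ℝ E] [CompleteSpace E]
  [NormedAddCommGroup F] [NormedSpace ℂ F] [CompleteSpace F]

/-- Both sides solve the same real differential equation. The complex exponential on the right
allows splitting off the complex scalar `μ`. -/
theorem exp_smul_restrictScalars_apply (T : F →L[ℂ] F) (v : F) {t : ℝ} (ht : 0 ≤ t) :
    NormedSpace.exp (t • T.restrictScalars ℝ) v = NormedSpace.exp ((t : ℂ) • T) v := by
  have hs : IsSolution (T.restrictScalars ℝ) (fun s => NormedSpace.exp ((s : ℂ) • T) v) := by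
    intro s _
    have h := (hasDerivAt_exp_smul_const' (𝕂 := ℂ) T (s : ℂ)).scomp s Complex.ofRealCLM.hasDerivAt
    simp only [Complex.ofRealCLM_apply, Complex.ofReal_one, one_smul] at h
    have h2 := ((ContinuousLinearMap.apply ℂ F v).restrictScalars ℝ).hasFDerivAt.comp_hasDerivAt s h
    exact h2.hasDerivWithinAt
  simpa [NormedSpace.exp_zero] using (eq_flow_of_isSolution hs ht).symm

theorem exp_smul_apply_of_pow_apply_eq_zero {N : F →L[ℂ] F} {v : F} {k : ℕ}
    (h : (N ^ k) v = 0) (t : ℂ) :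
    NormedSpace.exp (t • N) v =
      ∑ j ∈ Finset.range k, ((j.factorial : ℂ)⁻¹ * t ^ j) • (N ^ j) v := by
  have h1 := (NormedSpace.exp_series_hasSum_exp' (𝕂 := ℂ) (t • N)).mapL
    (ContinuousLinearMap.apply ℂ F v)
  have h0 : ∀ b ∉ Finset.range k, ContinuousLinearMap.apply ℂ F v
      (((b.factorial : ℂ)⁻¹) • (t • N) ^ b) = 0 := fun b hb => by
    obtain ⟨c, rfl⟩ := Nat.exists_eq_add_of_le' (not_lt.1 (Finset.mem_range.not.1 hb))
    simp [smul_pow, pow_add, h]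
  refine (h1.unique (hasSum_sum_of_ne_finset_zero h0)).trans (Finset.sum_congr rfl fun j _ => ?_)
  simp [smul_pow, mul_smul]

theorem tendsto_exp_mul_pow_nhds_zero {μ : ℂ} (hμ : μ.re < 0) (j : ℕ) :
    Tendsto (fun t : ℝ => Complex.exp (t * μ) * (t : ℂ) ^ j) atTop (𝓝 0) := by
  rw [tendsto_zero_iff_norm_tendsto_zero]
  have hb : 0 < -μ.re := by linarith
  have h := (isLittleO_pow_exp_pos_mul_atTop j hb).tendsto_div_nhds_zero
  refine h.congr' ?_
  filter_upwards [eventually_ge_atTop 0] with t ht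
  rw [norm_mul, Complex.norm_exp, norm_pow, Complex.norm_real, Real.norm_of_nonneg ht,
    div_eq_mul_inv, ← Real.exp_neg, mul_comm]
  simp [mul_comm]

/-- Splitting `T = μ + (T - μ)` into commuting parts, the second factor of the exponential is a
terminating series on `v`; the decay of `exp (t μ)` beats this polynomial. -/
theorem mem_stableSubspace_of_genEigenvector {T : F →L[ℂ] F} {μ : ℂ} (hμ : μ.re < 0) {v : F}
    {k : ℕ} (h : ((T - μ • 1) ^ k) v = 0) : v ∈ stableSubspace (T.restrictScalars ℝ) := by
  let _ : NormedAlgebra ℚ (F →L[ℂ] F) := NormedAlgebra.restrictScalars ℚ ℂ _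
  have key : ∀ t : ℝ, 0 ≤ t → NormedSpace.exp (t • T.restrictScalars ℝ) v =
      ∑ j ∈ Finset.range k,
        (Complex.exp (t * μ) * (t : ℂ) ^ j) • ((j.factorial : ℂ)⁻¹ • ((T - μ • 1) ^ j) v) := by
    intro t ht
    have hT : (t : ℂ) • T = algebraMap ℂ (F →L[ℂ] F) (t * μ) + (t : ℂ) • (T - μ • 1) := by
      rw [Algebra.algebraMap_eq_smul_one, smul_sub, smul_smul]; abel
    rw [exp_smul_restrictScalars_apply T v ht, hT,
      NormedSpace.exp_add_of_commute (Algebra.commutes _ _), ← NormedSpace.algebraMap_exp_comm,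
      Algebra.algebraMap_eq_smul_one, mul_apply_eq_comp,
      exp_smul_apply_of_pow_apply_eq_zero h, ← Complex.exp_eq_exp_ℂ]
    simp only [_root_.smul_apply, one_apply_eq_self, Finset.smul_sum,
      smul_smul]
    refine Finset.sum_congr rfl fun j _ => ?_
    congr 1; ring
  rw [mem_stableSubspace]
  have hlim : Tendsto (fun t : ℝ => ∑ j ∈ Finset.range k,
        (Complex.exp (t * μ) * (t : ℂ) ^ j) • ((j.factorial : ℂ)⁻¹ • ((T - μ • 1) ^ j) v))
      atTop (𝓝 0) := by
    have := tendsto_finsetSum (Finset.range k) fun j _ =>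
      (tendsto_exp_mul_pow_nhds_zero hμ j).smul_const ((j.factorial : ℂ)⁻¹ • ((T - μ • 1) ^ j) v)
    simpa using this
  refine hlim.congr' ?_
  filter_upwards [eventually_ge_atTop 0] with t ht using (key t ht).symm

/-- Multiplication by `c` commutes with `T`, hence with its flow. This recovers the complex
structure that a real submodule does not record. -/
theorem smul_mem_stableSubspace_restrictScalars {T : F →L[ℂ] F} (c : ℂ) {v : F}
    (hv : v ∈ stableSubspace (T.restrictScalars ℝ)) :
    c • v ∈ stableSubspace (T.restrictScalars ℝ) :=
  map_mem_stableSubspace (ι := (c • ContinuousLinearMap.id ℂ F).restrictScalars ℝ)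
    (fun v => (T.map_smul c v).symm) hv

omit [CompleteSpace F] in
theorem eq_zero_of_pow_apply_eq_zero {N : F →L[ℂ] F} (hN : ∀ v, N v = 0 → v = 0) {k : ℕ} {v : F}
    (h : (N ^ k) v = 0) : v = 0 := by
  induction k with
  | zero => simpa using h
  | succ k ih => exact ih (hN _ (by rwa [pow_succ'] at h))

omit [CompleteSpace F] in
/-- If every generalized eigenvector lies in a real subspace, the subspace is everything. -/
theorem eq_top_of_genEigenvector_mem [FiniteDimensional ℂ F] (T : F →L[ℂ] F) (V : Submodule ℝ F)
    (h : ∀ (μ : ℂ) (k : ℕ) (v : F), ((T - μ • 1) ^ k) v = 0 → v ∈ V) : V = ⊤ := by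
  refine eq_top_iff.2 fun v _ => ?_
  have hv : v ∈ ⨆ μ : ℂ, Module.End.maxGenEigenspace (T : Module.End ℂ F) μ := by
    rw [Module.End.iSup_maxGenEigenspace_eq_top]; trivial
  refine Submodule.iSup_induction _ (motive := (· ∈ V)) hv (fun μ x hx => ?_) V.zero_mem
    fun _ _ => V.add_mem
  obtain ⟨k, hk⟩ := (Module.End.mem_maxGenEigenspace _ _ _).1 hx
  refine h μ k x ?_
  have hp : ∀ (k : ℕ) (y : F), ((T - μ • 1) ^ k) y =
      (((T : Module.End ℂ F) - μ • (1 : Module.End ℂ F)) ^ k) y := by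
    intro k
    induction k with
    | zero => simp
    | succ k ih => intro y; rw [pow_succ, pow_succ]; simp [ih]
  rw [hp, hk]

/-- A complex linear map without imaginary eigenvalues splits the space into the forward and the
backward stable subspace. -/
theorem stableSubspace_sup_stableSubspace_neg_eq_top [FiniteDimensional ℂ F] {T : F →L[ℂ] F}
    (h : ∀ (μ : ℂ) (v : F), μ.re = 0 → T v = μ • v → v = 0) :
    stableSubspace (T.restrictScalars ℝ) ⊔ stableSubspace ((-T).restrictScalars ℝ) = ⊤ := by
  refine eq_top_of_genEigenvector_mem T _ fun μ k v hv => ?_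
  rcases lt_trichotomy μ.re 0 with hμ | hμ | hμ
  · exact Submodule.mem_sup_left (mem_stableSubspace_of_genEigenvector hμ hv)
  · rw [eq_zero_of_pow_apply_eq_zero (fun w hw => h μ w hμ (sub_eq_zero.1 hw)) hv]
    exact Submodule.zero_mem _
  · refine Submodule.mem_sup_right
      (mem_stableSubspace_of_genEigenvector (μ := -μ) (k := k) (by simpa using hμ) ?_)
    rw [show -T - (-μ) • (1 : F →L[ℂ] F) = -(T - μ • 1) by rw [neg_smul]; abel, neg_pow]
    simp only [mul_apply_eq_comp, hv, map_zero]

theorem stableSubspace_restrictScalars_eq_top [FiniteDimensional ℂ F] {T : F →L[ℂ] F}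
    (h : ∀ (μ : ℂ) (v : F), 0 ≤ μ.re → T v = μ • v → v = 0) :
    stableSubspace (T.restrictScalars ℝ) = ⊤ := by
  refine eq_top_of_genEigenvector_mem T _ fun μ k v hv => ?_
  rcases lt_or_ge μ.re 0 with hμ | hμ
  · exact mem_stableSubspace_of_genEigenvector hμ hv
  · rw [eq_zero_of_pow_apply_eq_zero (fun w hw => h μ w hμ (sub_eq_zero.1 hw)) hv]
    exact Submodule.zero_mem _

/-- A real linear map with a complexification `T` (with `ι` the inclusion of the real points and
`ρ` the real part) none of whose eigenvalues is imaginary splits the space. -/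
theorem stableSubspace_sup_stableSubspace_neg_eq_top_of_complexification [FiniteDimensional ℂ F]
    {L : E →L[ℝ] E} {T : F →L[ℂ] F} {ι : E →L[ℝ] F} {ρ : F →L[ℝ] E} (hρι : ∀ v, ρ (ι v) = v)
    (hρ : ∀ w, ρ (T w) = L (ρ w)) (h : ∀ (μ : ℂ) (v : F), μ.re = 0 → T v = μ • v → v = 0) :
    stableSubspace L ⊔ stableSubspace (-L) = ⊤ := by
  refine eq_top_iff.2 fun v _ => ?_
  have hv : ι v ∈ stableSubspace (T.restrictScalars ℝ) ⊔
      stableSubspace ((-T).restrictScalars ℝ) := by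
    rw [stableSubspace_sup_stableSubspace_neg_eq_top h]; trivial
  obtain ⟨a, ha, b, hb, hab⟩ := Submodule.mem_sup.1 hv
  -- The real part intertwines `T` with `L`, and `-T` with `-L`, so it carries stable vectors to
  -- stable vectors.
  refine Submodule.mem_sup.2 ⟨ρ a, map_mem_stableSubspace (fun w => hρ w) ha, ρ b,
    map_mem_stableSubspace (T := -L) (fun w => ?_) hb, by rw [← map_add, hab, hρι]⟩
  simp [hρ]

theorem stableSubspace_eq_top_of_complexification [FiniteDimensional ℂ F]
    {L : E →L[ℝ] E} {T : F →L[ℂ] F} {ι : E →L[ℝ] F} {ρ : F →L[ℝ] E} (hρι : ∀ v, ρ (ι v) = v)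
    (hρ : ∀ w, ρ (T w) = L (ρ w)) (h : ∀ (μ : ℂ) (v : F), 0 ≤ μ.re → T v = μ • v → v = 0) :
    stableSubspace L = ⊤ := by
  refine eq_top_iff.2 fun v _ => ?_
  have hv : ι v ∈ stableSubspace (T.restrictScalars ℝ) := by
    rw [stableSubspace_restrictScalars_eq_top h]; trivial
  rw [← hρι v]
  exact map_mem_stableSubspace (fun w => hρ w) hv

end Spectrum

/-! ### Complexification of real matrices -/

section Complexification

variable {ι κ : Type*}

/-- The complexification of a real matrix. -/
abbrev Matrix.complexify (M : Matrix ι κ ℝ) : Matrix ι κ ℂ := M.map (fun a : ℝ => (a : ℂ))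

/-- The inclusion of real vectors into complex vectors. -/
noncomputable def vecOfReal (ι : Type*) : (ι → ℝ) →L[ℝ] (ι → ℂ) :=
  ContinuousLinearMap.pi fun i => Complex.ofRealCLM.comp (ContinuousLinearMap.proj i)

/-- The real part of a complex vector. -/
noncomputable def vecRe (ι : Type*) : (ι → ℂ) →L[ℝ] (ι → ℝ) :=
  ContinuousLinearMap.pi fun i => Complex.reCLM.comp (ContinuousLinearMap.proj i)

/-- The imaginary part of a complex vector. -/
noncomputable def vecIm (ι : Type*) : (ι → ℂ) →L[ℝ] (ι → ℝ) :=
  ContinuousLinearMap.pi fun i => Complex.imCLM.comp (ContinuousLinearMap.proj i)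

@[simp] theorem vecOfReal_apply (x : ι → ℝ) (i : ι) : vecOfReal ι x i = x i := rfl
@[simp] theorem vecRe_apply (w : ι → ℂ) (i : ι) : vecRe ι w i = (w i).re := rfl
@[simp] theorem vecIm_apply (w : ι → ℂ) (i : ι) : vecIm ι w i = (w i).im := rfl

@[simp] theorem vecRe_vecOfReal (x : ι → ℝ) : vecRe ι (vecOfReal ι x) = x := by ext; simp

theorem vecOfReal_add_I_smul (w : ι → ℂ) :
    vecOfReal ι (vecRe ι w) + Complex.I • vecOfReal ι (vecIm ι w) = w := by
  ext i
  simp [mul_comm Complex.I, Complex.re_add_im]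

theorem vecRe_smul (μ : ℂ) (w : ι → ℂ) :
    vecRe ι (μ • w) = μ.re • vecRe ι w - μ.im • vecIm ι w := by ext; simp

theorem vecIm_smul (μ : ℂ) (w : ι → ℂ) :
    vecIm ι (μ • w) = μ.re • vecIm ι w + μ.im • vecRe ι w := by ext; simp

theorem complex_vec_ext {v w : ι → ℂ} (hre : vecRe ι v = vecRe ι w) (him : vecIm ι v = vecIm ι w) :
    v = w := by
  ext i
  exact Complex.ext (congrFun hre i) (congrFun him i)

variable [Fintype κ]

theorem vecRe_mulVec (M : Matrix ι κ ℝ) (w : κ → ℂ) :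
    vecRe ι (M.complexify *ᵥ w) = M *ᵥ vecRe κ w := by
  ext; simp [mulVec, dotProduct]

theorem vecIm_mulVec (M : Matrix ι κ ℝ) (w : κ → ℂ) :
    vecIm ι (M.complexify *ᵥ w) = M *ᵥ vecIm κ w := by
  ext; simp [mulVec, dotProduct]

theorem vecOfReal_mulVec (M : Matrix ι κ ℝ) (x : κ → ℝ) :
    vecOfReal ι (M *ᵥ x) = M.complexify *ᵥ vecOfReal κ x := by
  ext; simp [mulVec, dotProduct]

theorem complexify_mul {l : Type*} (M : Matrix ι κ ℝ) (N : Matrix κ l ℝ) :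
    (M * N).complexify = M.complexify * N.complexify :=
  Matrix.map_mul (f := Complex.ofRealHom)

omit [Fintype κ] in
theorem complexify_transpose (M : Matrix ι κ ℝ) : Mᵀ.complexify = M.complexifyᵀ := rfl

end Complexification

/-! ### The Popov–Belevitch–Hautus test -/

theorem IsHurwitz.eq_zero_of_mulVec_eq_smul {ι : Type*} [Fintype ι] [DecidableEq ι]
    {M : Matrix ι ι ℝ} (hM : IsHurwitz M) {μ : ℂ} (hμ : 0 ≤ μ.re) {w : ι → ℂ}
    (hw : M.complexify *ᵥ w = μ • w) : w = 0 := by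
  by_contra h0
  refine (hM μ (Module.End.hasEigenvalue_of_hasEigenvector (x := w) ⟨?_, h0⟩)).not_ge hμ
  rw [Module.End.mem_eigenspace_iff, Matrix.toLin'_apply, hw]

theorem IsHurwitz.transpose {ι : Type*} [Fintype ι] [DecidableEq ι]
    {M : Matrix ι ι ℝ} (hM : IsHurwitz M) : IsHurwitz Mᵀ := by
  intro μ hμ
  refine hM μ ?_
  rw [Module.End.hasEigenvalue_iff_isRoot_charpoly, Matrix.charpoly_toLin'] at hμ ⊢
  rwa [← Matrix.charpoly_transpose]

section Exponential

variable {ι : Type*} [Fintype ι] [DecidableEq ι]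

-- A left eigenfunctional of `A` is one of every power of `A`, hence of the exponential series.
-- Taking `φ` real-linear with complex values lets a complex left eigenvector act on real states.
attribute [local instance] Matrix.linftyOpNormedRing Matrix.linftyOpNormedAlgebra in
theorem apply_exp_mulVec_of_eigen {A : Matrix ι ι ℝ} {φ : (ι → ℝ) →ₗ[ℝ] ℂ} {μ : ℂ}
    (hφ : ∀ x, φ (A *ᵥ x) = μ * φ x) (s : ℝ) (x : ι → ℝ) :
    φ (NormedSpace.exp (s • A) *ᵥ x) = Complex.exp (s * μ) * φ x := by
  have hpow : ∀ (k : ℕ) (y : ι → ℝ), φ ((A ^ k) *ᵥ y) = μ ^ k * φ y := by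
    intro k
    induction k with
    | zero => simp
    | succ k ih => intro y; rw [pow_succ, ← mulVec_mulVec, ih, hφ, pow_succ, mul_assoc]
  let ψ : Matrix ι ι ℝ →L[ℝ] ℂ := LinearMap.toContinuousLinearMap
    { toFun := fun M => φ (M *ᵥ x)
      map_add' := fun M N => by rw [add_mulVec, map_add]
      map_smul' := fun c M => by rw [smul_mulVec, map_smul]; rfl }
  have h1 : HasSum (fun k : ℕ => ψ ((k.factorial : ℝ)⁻¹ • (s • A) ^ k))
      (ψ (NormedSpace.exp (s • A))) :=
    (NormedSpace.exp_series_hasSum_exp' (𝕂 := ℝ) (s • A)).mapL ψ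
  have h2 := (NormedSpace.exp_series_hasSum_exp' (𝕂 := ℂ) ((s : ℂ) * μ)).mul_right (φ x)
  rw [← Complex.exp_eq_exp_ℂ] at h2
  refine h1.unique (h2.congr_fun fun k => ?_)
  rw [smul_pow, map_smul, map_smul]
  change _ • _ • φ ((A ^ k) *ᵥ x) = _
  rw [hpow]
  simp [mul_pow, mul_assoc]

end Exponential

section PBH

variable {n m : ℕ}

/-- A left eigenvector that annihilates `B` does not see the input: along any trajectory its value
is only multiplied by `exp (t μ)`. Steering to the origin thus forces it to vanish at the initial
state. -/
theorem IsControllable.eq_zero_of_vecMul {A : Matrix (Fin n) (Fin n) ℝ}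
    {B : Matrix (Fin n) (Fin m) ℝ} (h : IsControllable A B) {μ : ℂ} {w : Fin n → ℂ}
    (hA : w ᵥ* A.complexify = μ • w) (hB : w ᵥ* B.complexify = 0) : w = 0 := by
  let φ : (Fin n → ℝ) →ₗ[ℝ] ℂ :=
    { toFun := fun x => w ⬝ᵥ vecOfReal _ x
      map_add' := fun x y => by rw [map_add, dotProduct_add]
      map_smul' := fun c x => by rw [map_smul, dotProduct_smul]; rfl }
  have hφA : ∀ x, φ (A *ᵥ x) = μ * φ x := fun x => by
    change w ⬝ᵥ vecOfReal _ (A *ᵥ x) = μ * (w ⬝ᵥ vecOfReal _ x)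
    rw [vecOfReal_mulVec, dotProduct_mulVec, hA, smul_dotProduct, smul_eq_mul]
  have hφB : ∀ u, φ (B *ᵥ u) = 0 := fun u => by
    change w ⬝ᵥ vecOfReal _ (B *ᵥ u) = 0
    rw [vecOfReal_mulVec, dotProduct_mulVec, hB, zero_dotProduct]
  have hφ : ∀ x, φ x = 0 := fun x => by
    obtain ⟨t, -, u, -, hx⟩ : x ∈ controllableSubspace A B := h ▸ mem_univ x
    have hint : φ (∫ τ in (0 : ℝ)..t, NormedSpace.exp ((t - τ) • A) *ᵥ (B *ᵥ u τ)) = 0 := by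
      by_cases hi : IntervalIntegrable
          (fun τ => NormedSpace.exp ((t - τ) • A) *ᵥ (B *ᵥ u τ)) volume 0 t
      · have := (LinearMap.toContinuousLinearMap φ).intervalIntegral_comp_comm hi
        rw [LinearMap.coe_toContinuousLinearMap'] at this
        rw [← this]
        simp only [apply_exp_mulVec_of_eigen hφA, hφB, mul_zero, intervalIntegral.integral_zero]
      -- A nonintegrable integrand has integral zero by convention, so integrability need not be
      -- derived from that of `u`.
      · rw [intervalIntegral.integral_undef hi, map_zero]
    have h0 := congrArg φ hx
    rw [map_add, hint, add_zero, map_zero, apply_exp_mulVec_of_eigen hφA] at h0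
    exact (mul_eq_zero.1 h0).resolve_left (Complex.exp_ne_zero _)
  ext i
  have := hφ (Pi.single i 1)
  change w ⬝ᵥ vecOfReal _ (Pi.single i 1) = 0 at this
  have hs : vecOfReal (Fin n) (Pi.single i 1) = Pi.single i 1 := by
    ext j
    by_cases hj : j = i
    · subst hj; simp
    · simp [hj]
  simpa [hs] using this

/-- In the decomposed coordinates the controllable component vanishes by the controllable case. What
remains is a left eigenvector of the Hurwitz block `Au` with `0 ≤ μ.re`. -/
theorem IsStabilizable.eq_zero_of_vecMul {A : Matrix (Fin n) (Fin n) ℝ}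
    {B : Matrix (Fin n) (Fin m) ℝ} (h : IsStabilizable A B) {μ : ℂ} (hμ : 0 ≤ μ.re)
    {w : Fin n → ℂ} (hA : w ᵥ* A.complexify = μ • w) (hB : w ᵥ* B.complexify = 0) : w = 0 := by
  obtain ⟨r, s, T, Tinv, Ac, A12, Au, Bc, hTT, -, hAT, hBT, hc, hu⟩ := h
  have hTT' : T.complexify * Tinv.complexify = 1 := by
    rw [← complexify_mul, hTT]
    exact Matrix.map_one _ Complex.ofReal_zero Complex.ofReal_one
  have hA' : (w ᵥ* T.complexify) ᵥ* (fromBlocks Ac A12 0 Au).complexify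
      = μ • (w ᵥ* T.complexify) := by
    rw [← hAT, complexify_mul, complexify_mul, vecMul_vecMul, ← Matrix.mul_assoc,
      ← Matrix.mul_assoc, hTT', Matrix.one_mul, ← vecMul_vecMul, hA, smul_vecMul]
  have hB' : (w ᵥ* T.complexify) ᵥ* (fromRows Bc (0 : Matrix (Fin s) (Fin m) ℝ)).complexify
      = 0 := by
    rw [← hBT, complexify_mul, vecMul_vecMul, ← Matrix.mul_assoc, hTT', Matrix.one_mul, hB]
  set v := w ᵥ* T.complexify with hv
  have hv0 : v = 0 := by
    have hA1 : (v ∘ Sum.inl) ᵥ* Ac.complexify = μ • (v ∘ Sum.inl) := by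
      ext i
      simpa [vecMul, dotProduct, Fintype.sum_sum_type] using congrFun hA' (Sum.inl i)
    have hB1 : (v ∘ Sum.inl) ᵥ* Bc.complexify = 0 := by
      ext i
      simpa [vecMul, dotProduct, Fintype.sum_sum_type] using congrFun hB' i
    have h1 := hc.eq_zero_of_vecMul hA1 hB1
    have h1' : ∀ i, v (Sum.inl i) = 0 := fun i => congrFun h1 i
    have hA2 : Auᵀ.complexify *ᵥ (v ∘ Sum.inr) = μ • (v ∘ Sum.inr) := by
      rw [complexify_transpose, mulVec_transpose]
      ext i
      simpa [vecMul, dotProduct, Fintype.sum_sum_type, h1'] using congrFun hA' (Sum.inr i)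
    have h2 := hu.transpose.eq_zero_of_mulVec_eq_smul hμ hA2
    ext (i | i)
    · exact h1' i
    · exact congrFun h2 i
  have : w = v ᵥ* Tinv.complexify := by rw [hv, vecMul_vecMul, hTT', vecMul_one]
  rw [this, hv0, zero_vecMul]

theorem IsDetectable.eq_zero_of_mulVec {A : Matrix (Fin n) (Fin n) ℝ}
    {C : Matrix (Fin m) (Fin n) ℝ} (h : IsDetectable A C) {μ : ℂ} (hμ : 0 ≤ μ.re)
    {w : Fin n → ℂ} (hA : A.complexify *ᵥ w = μ • w) (hC : C.complexify *ᵥ w = 0) : w = 0 :=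
  IsStabilizable.eq_zero_of_vecMul h hμ (by rwa [complexify_transpose, vecMul_transpose])
    (by rwa [complexify_transpose, vecMul_transpose])

end PBH

/-! ### The Hamiltonian flow and the algebraic Riccati equation -/

section Riccati

theorem HasDerivAt.dotProduct {ι : Type*} [Fintype ι] {f g : ℝ → ι → ℝ} {f' g' : ι → ℝ} {t : ℝ}
    (hf : HasDerivAt f f' t) (hg : HasDerivAt g g' t) :
    HasDerivAt (fun s => f s ⬝ᵥ g s) (f' ⬝ᵥ g t + f t ⬝ᵥ g') t := by
  have h := HasDerivAt.fun_sum (u := Finset.univ) fun i _ =>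
    ((hasDerivAt_pi.1 hf i).mul (hasDerivAt_pi.1 hg i))
  simpa [_root_.dotProduct, Finset.sum_add_distrib] using h

variable {ι : Type*} [Fintype ι]

/-- The Hamiltonian map `(x, l) ↦ (A x - G l, -Q x - Aᵀ l)`. -/
noncomputable def hamiltonianMap {𝕜 : Type*} [RCLike 𝕜] (A G Q : Matrix ι ι 𝕜) :
    (ι → 𝕜) × (ι → 𝕜) →L[𝕜] (ι → 𝕜) × (ι → 𝕜) :=
  LinearMap.toContinuousLinearMap
    ((A.mulVecLin ∘ₗ LinearMap.fst 𝕜 _ _ - G.mulVecLin ∘ₗ LinearMap.snd 𝕜 _ _).prod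
      (-(Q.mulVecLin ∘ₗ LinearMap.fst 𝕜 _ _) - Aᵀ.mulVecLin ∘ₗ LinearMap.snd 𝕜 _ _))

@[simp] theorem hamiltonianMap_apply {𝕜 : Type*} [RCLike 𝕜] (A G Q : Matrix ι ι 𝕜)
    (v : (ι → 𝕜) × (ι → 𝕜)) :
    hamiltonianMap A G Q v = (A *ᵥ v.1 - G *ᵥ v.2, -(Q *ᵥ v.1) - Aᵀ *ᵥ v.2) := rfl

theorem HasDerivAt.prod_fst {E F : Type*} [NormedAddCommGroup E] [NormedSpace ℝ E]
    [NormedAddCommGroup F] [NormedSpace ℝ F] {z : ℝ → E × F} {z' : E × F} {t : ℝ}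
    (h : HasDerivAt z z' t) : HasDerivAt (fun s => (z s).1) z'.1 t :=
  (ContinuousLinearMap.fst ℝ E F).hasFDerivAt.comp_hasDerivAt t h

theorem HasDerivAt.prod_snd {E F : Type*} [NormedAddCommGroup E] [NormedSpace ℝ E]
    [NormedAddCommGroup F] [NormedSpace ℝ F] {z : ℝ → E × F} {z' : E × F} {t : ℝ}
    (h : HasDerivAt z z' t) : HasDerivAt (fun s => (z s).2) z'.2 t :=
  (ContinuousLinearMap.snd ℝ E F).hasFDerivAt.comp_hasDerivAt t h

/-- The symplectic form. -/
def symplecticForm (a b : (ι → ℝ) × (ι → ℝ)) : ℝ := a.1 ⬝ᵥ b.2 - a.2 ⬝ᵥ b.1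

theorem tendsto_dotProduct_zero {f g : ℝ → ι → ℝ} (hf : Tendsto f atTop (𝓝 0))
    (hg : Tendsto g atTop (𝓝 0)) : Tendsto (fun t => f t ⬝ᵥ g t) atTop (𝓝 0) := by
  have := tendsto_finsetSum (Finset.univ : Finset ι) fun i _ =>
    (tendsto_pi_nhds.1 hf i).mul (tendsto_pi_nhds.1 hg i)
  simpa [dotProduct] using this

/-- The stable subspace of an infinitesimally symplectic map is isotropic. -/
theorem symplecticForm_eq_zero_of_mem_stableSubspace
    {L : (ι → ℝ) × (ι → ℝ) →L[ℝ] (ι → ℝ) × (ι → ℝ)}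
    (hL : ∀ a b, symplecticForm (L a) b + symplecticForm a (L b) = 0) {a b : (ι → ℝ) × (ι → ℝ)}
    (ha : a ∈ stableSubspace L) (hb : b ∈ stableSubspace L) : symplecticForm a b = 0 := by
  let g : ℝ → ℝ := fun t =>
    symplecticForm (NormedSpace.exp (t • L) a) (NormedSpace.exp (t • L) b)
  -- The form is conserved along the pair of orbits and tends to zero, so it is zero from the start.
  have hg : ∀ t, HasDerivAt g 0 t := fun t => by
    have h1 := hasDerivAt_flow L a t
    have h2 := hasDerivAt_flow L b t
    refine ((h1.prod_fst.dotProduct h2.prod_snd).sub (h1.prod_snd.dotProduct h2.prod_fst)).congr_deriv ?_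
    rw [← hL (NormedSpace.exp (t • L) a) (NormedSpace.exp (t • L) b)]
    simp only [symplecticForm]
    ring
  have hconst : ∀ t, g t = g 0 := fun t =>
    is_const_of_deriv_eq_zero (fun t => (hg t).differentiableAt) (fun t => (hg t).deriv) t 0
  have hlim : Tendsto g atTop (𝓝 0) := by
    have ha' := (Prod.tendsto_iff _ _).1 (mem_stableSubspace.1 ha)
    have hb' := (Prod.tendsto_iff _ _).1 (mem_stableSubspace.1 hb)
    simpa [g, symplecticForm] using (tendsto_dotProduct_zero ha'.1 hb'.2).sub (tendsto_dotProduct_zero ha'.2 hb'.1)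
  have h0 : g 0 = 0 :=
    tendsto_nhds_unique (tendsto_const_nhds.congr fun t => (hconst t).symm) hlim
  simpa [g, NormedSpace.exp_zero] using h0

theorem dotProduct_mulVec_comm_of_transpose_eq {M : Matrix ι ι ℝ} (hM : Mᵀ = M) (x y : ι → ℝ) :
    x ⬝ᵥ M *ᵥ y = (M *ᵥ x) ⬝ᵥ y := by
  rw [dotProduct_mulVec, ← mulVec_transpose, hM]

theorem symplecticForm_hamiltonianMap {A G Q : Matrix ι ι ℝ} (hG : Gᵀ = G) (hQ : Qᵀ = Q)
    (a b : (ι → ℝ) × (ι → ℝ)) :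
    symplecticForm (hamiltonianMap A G Q a) b + symplecticForm a (hamiltonianMap A G Q b) = 0 := by
  have h1 := dotProduct_mulVec_comm_of_transpose_eq hG a.2 b.2
  have h2 := dotProduct_mulVec_comm_of_transpose_eq hQ a.1 b.1
  have h3 : a.1 ⬝ᵥ Aᵀ *ᵥ b.2 = (A *ᵥ a.1) ⬝ᵥ b.2 := by
    rw [dotProduct_mulVec, vecMul_transpose]
  have h4 : (Aᵀ *ᵥ a.2) ⬝ᵥ b.1 = a.2 ⬝ᵥ A *ᵥ b.1 := by
    rw [dotProduct_mulVec, mulVec_transpose]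
  simp only [symplecticForm, hamiltonianMap_apply, sub_dotProduct, dotProduct_sub, neg_dotProduct,
    dotProduct_neg]
  linarith

/-- A nonzero eigenvector for an eigenvalue with nonnegative real part is not stable. -/
theorem eq_zero_of_eigenvector_mem_stableSubspace {F : Type*} [NormedAddCommGroup F]
    [NormedSpace ℂ F] [CompleteSpace F] {T : F →L[ℂ] F} {μ : ℂ} (hμ : 0 ≤ μ.re) {v : F}
    (hv : T v = μ • v) (h : v ∈ stableSubspace (T.restrictScalars ℝ)) : v = 0 := by
  have hs : IsSolution (T.restrictScalars ℝ) (fun t : ℝ => Complex.exp (t * μ) • v) := by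
    intro t _
    have h1 := ((Complex.ofRealCLM.hasDerivAt (x := t)).mul_const μ).cexp.smul_const v
    refine (h1.congr_deriv ?_).hasDerivWithinAt
    simp [hv, smul_smul]
  have hlim : Tendsto (fun t : ℝ => ‖Complex.exp (t * μ) • v‖) atTop (𝓝 0) := by
    have := (mem_stableSubspace.1 h).norm
    rw [norm_zero] at this
    refine this.congr' ?_
    filter_upwards [eventually_ge_atTop 0] with t ht
    rw [eq_flow_of_isSolution hs ht]
    simp
  have hle : ‖v‖ ≤ 0 := by
    refine ge_of_tendsto hlim ?_
    filter_upwards [eventually_ge_atTop 0] with t ht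
    rw [norm_smul, Complex.norm_exp]
    refine le_mul_of_one_le_left (norm_nonneg _) (Real.one_le_exp ?_)
    simpa using mul_nonneg ht hμ
  simpa using hle

omit [Fintype ι] in
theorem isHermitian_transpose_eq {M : Matrix ι ι ℝ} (hM : M.IsHermitian) : Mᵀ = M := by
  rw [← conjTranspose_eq_transpose_of_trivial, hM.eq]

theorem posSemidef_nonneg {M : Matrix ι ι ℝ} (hM : M.PosSemidef) (x : ι → ℝ) :
    0 ≤ x ⬝ᵥ M *ᵥ x := by simpa using hM.dotProduct_mulVec_nonneg x

theorem posSemidef_mulVec_eq_zero {M : Matrix ι ι ℝ} (hM : M.PosSemidef) {x : ι → ℝ}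
    (h : x ⬝ᵥ M *ᵥ x = 0) : M *ᵥ x = 0 :=
  (hM.dotProduct_mulVec_zero_iff x).1 (by simpa using h)

theorem posDef_eq_zero [DecidableEq ι] {M : Matrix ι ι ℝ} (hM : M.PosDef) {x : ι → ℝ}
    (h : x ⬝ᵥ M *ᵥ x = 0) : x = 0 := by
  by_contra hx
  have := hM.dotProduct_mulVec_pos hx
  simp [h] at this

variable {n m : ℕ} {A : Matrix (Fin n) (Fin n) ℝ} {B : Matrix (Fin n) (Fin m) ℝ}
  {Q : Matrix (Fin n) (Fin n) ℝ} {R : Matrix (Fin m) (Fin m) ℝ}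

theorem dotProduct_inputMatrix_mulVec (B : Matrix (Fin n) (Fin m) ℝ) (R : Matrix (Fin m) (Fin m) ℝ)
    (x y : Fin n → ℝ) :
    x ⬝ᵥ (B * R⁻¹ * Bᵀ) *ᵥ y = (Bᵀ *ᵥ x) ⬝ᵥ R⁻¹ *ᵥ (Bᵀ *ᵥ y) := by
  rw [← mulVec_mulVec, ← mulVec_mulVec, dotProduct_mulVec, mulVec_transpose B x]

theorem inputMatrix_transpose (hR : R.PosDef) : (B * R⁻¹ * Bᵀ)ᵀ = B * R⁻¹ * Bᵀ := by
  rw [transpose_mul, transpose_mul, transpose_transpose,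
    isHermitian_transpose_eq hR.inv.isHermitian, Matrix.mul_assoc]

theorem inputMatrix_nonneg (hR : R.PosDef) (x : Fin n → ℝ) :
    0 ≤ x ⬝ᵥ (B * R⁻¹ * Bᵀ) *ᵥ x := by
  rw [dotProduct_inputMatrix_mulVec]
  exact posSemidef_nonneg hR.inv.posSemidef _

theorem transpose_mulVec_eq_zero_of_inputMatrix (hR : R.PosDef) {x : Fin n → ℝ}
    (h : x ⬝ᵥ (B * R⁻¹ * Bᵀ) *ᵥ x = 0) : Bᵀ *ᵥ x = 0 := by
  rw [dotProduct_inputMatrix_mulVec] at h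
  exact posDef_eq_zero hR.inv h

theorem inputMatrix_mulVec_eq_zero {x : Fin n → ℝ} (h : Bᵀ *ᵥ x = 0) :
    (B * R⁻¹ * Bᵀ) *ᵥ x = 0 := by
  rw [← mulVec_mulVec, h, mulVec_zero]

theorem complex_mulVec_eq_zero {κ : Type*} {M : Matrix κ (Fin n) ℝ} {w : Fin n → ℂ}
    (hre : M *ᵥ vecRe _ w = 0) (him : M *ᵥ vecIm _ w = 0) : M.complexify *ᵥ w = 0 :=
  complex_vec_ext (by rw [vecRe_mulVec, hre, map_zero]) (by rw [vecIm_mulVec, him, map_zero])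

/-- The Hamiltonian matrix has no imaginary eigenvalues. -/
theorem hamiltonianMap_eq_zero_of_imaginary_eigenvalue (hQ : Q.PosSemidef) (hR : R.PosDef)
    (hstab : IsStabilizable A B) (hdet : IsDetectable A Q) {μ : ℂ} (hμ : μ.re = 0)
    {v : (Fin n → ℂ) × (Fin n → ℂ)}
    (hv : hamiltonianMap A.complexify (B * R⁻¹ * Bᵀ).complexify Q.complexify v = μ • v) :
    v = 0 := by
  obtain ⟨x, l⟩ := v
  rw [hamiltonianMap_apply, Prod.smul_mk, Prod.mk.injEq] at hv
  obtain ⟨h1, h2⟩ := hv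
  simp only at h1 h2
  rw [← complexify_transpose] at h2
  have h1r := congrArg (vecRe _) h1
  have h1i := congrArg (vecIm _) h1
  have h2r := congrArg (vecRe _) h2
  have h2i := congrArg (vecIm _) h2
  simp only [map_sub, map_neg, vecRe_mulVec, vecIm_mulVec, vecRe_smul, vecIm_smul, hμ, zero_smul,
    zero_sub, zero_add] at h1r h1i h2r h2i
  set x₁ := vecRe _ x
  set x₂ := vecIm _ x
  set l₁ := vecRe _ l
  set l₂ := vecIm _ l
  -- Pairing the first equation with `l` and the second with `x` and adding, the terms in `A` and in
  -- `μ.im` cancel. What is left says that four nonnegative values, of `Q` at `x₁`, `x₂` and of `B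
  -- R⁻¹ Bᵀ` at `l₁`, `l₂`, sum to zero.
  have e1 := congrArg (l₁ ⬝ᵥ ·) h1r
  have e2 := congrArg (l₂ ⬝ᵥ ·) h1i
  have e3 := congrArg (x₁ ⬝ᵥ ·) h2r
  have e4 := congrArg (x₂ ⬝ᵥ ·) h2i
  simp only [dotProduct_sub, dotProduct_neg, dotProduct_smul, smul_eq_mul,
    dotProduct_mulVec _ Aᵀ, vecMul_transpose] at e1 e2 e3 e4
  rw [dotProduct_comm _ l₁] at e3
  rw [dotProduct_comm _ l₂] at e4
  rw [dotProduct_comm l₁ x₂] at e1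
  rw [dotProduct_comm l₂ x₁] at e2
  have q1 := posSemidef_nonneg hQ x₁
  have q2 := posSemidef_nonneg hQ x₂
  have g1 := inputMatrix_nonneg (B := B) hR l₁
  have g2 := inputMatrix_nonneg (B := B) hR l₂
  have hQ1 := posSemidef_mulVec_eq_zero hQ (x := x₁) (by linarith)
  have hQ2 := posSemidef_mulVec_eq_zero hQ (x := x₂) (by linarith)
  have hB1 := transpose_mulVec_eq_zero_of_inputMatrix (B := B) hR (x := l₁) (by linarith)
  have hB2 := transpose_mulVec_eq_zero_of_inputMatrix (B := B) hR (x := l₂) (by linarith)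
  have hQx : Q.complexify *ᵥ x = 0 := complex_mulVec_eq_zero hQ1 hQ2
  have hBl : Bᵀ.complexify *ᵥ l = 0 := complex_mulVec_eq_zero hB1 hB2
  have hGl : (B * R⁻¹ * Bᵀ).complexify *ᵥ l = 0 := by
    rw [complexify_mul, ← mulVec_mulVec, hBl, mulVec_zero]
  rw [hGl, sub_zero] at h1
  rw [hQx, neg_zero, zero_sub] at h2
  -- The equations have decoupled: `x` is an eigenvector of `A` killed by `Q`, and `l` is a left
  -- eigenvector of `A` for `-μ` killing `B`.
  have hx := hdet.eq_zero_of_mulVec hμ.ge h1 hQx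
  have hl : l = 0 := hstab.eq_zero_of_vecMul (μ := -μ) (by simp [hμ])
    (by rw [← mulVec_transpose, ← complexify_transpose, neg_smul, ← h2, neg_neg])
    (by rw [← mulVec_transpose, ← complexify_transpose, hBl])
  rw [hx, hl]; rfl

theorem vecOfReal_hamiltonianMap (A G Q : Matrix (Fin n) (Fin n) ℝ)
    (v : (Fin n → ℝ) × (Fin n → ℝ)) :
    (vecOfReal (Fin n)).prodMap (vecOfReal (Fin n)) (hamiltonianMap A G Q v) =
      hamiltonianMap A.complexify G.complexify Q.complexify
        ((vecOfReal (Fin n)).prodMap (vecOfReal (Fin n)) v) := by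
  simp [vecOfReal_mulVec, complexify_transpose]

theorem vecRe_hamiltonianMap (A G Q : Matrix (Fin n) (Fin n) ℝ)
    (v : (Fin n → ℂ) × (Fin n → ℂ)) :
    (vecRe (Fin n)).prodMap (vecRe (Fin n))
        (hamiltonianMap A.complexify G.complexify Q.complexify v) =
      hamiltonianMap A G Q ((vecRe (Fin n)).prodMap (vecRe (Fin n)) v) := by
  simp [vecRe_mulVec, ← complexify_transpose]

theorem stableSubspace_hamiltonianMap_sup (hQ : Q.PosSemidef) (hR : R.PosDef)
    (hstab : IsStabilizable A B) (hdet : IsDetectable A Q) :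
    stableSubspace (hamiltonianMap A (B * R⁻¹ * Bᵀ) Q) ⊔
      stableSubspace (-hamiltonianMap A (B * R⁻¹ * Bᵀ) Q) = ⊤ :=
  stableSubspace_sup_stableSubspace_neg_eq_top_of_complexification
    (ι := (vecOfReal (Fin n)).prodMap (vecOfReal (Fin n)))
    (ρ := (vecRe (Fin n)).prodMap (vecRe (Fin n))) (fun _ => Prod.ext (vecRe_vecOfReal _) (vecRe_vecOfReal _))
    (vecRe_hamiltonianMap A _ Q)
    fun _ _ hμ hv => hamiltonianMap_eq_zero_of_imaginary_eigenvalue hQ hR hstab hdet hμ hv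

/-- The stable subspace of the Hamiltonian map contains no vector `(0, l)` with `l ≠ 0`. -/
theorem eq_zero_of_mem_stableSubspace_hamiltonianMap (hQ : Q.PosSemidef) (hR : R.PosDef)
    (hstab : IsStabilizable A B) {l : Fin n → ℝ}
    (hl : (0, l) ∈ stableSubspace (hamiltonianMap A (B * R⁻¹ * Bᵀ) Q)) : l = 0 := by
  set G := B * R⁻¹ * Bᵀ with hG
  -- Isotropy applied to `(0, k)` and its image `(-G k, -Aᵀ k)` gives `k ⬝ G k = 0`.
  have hBl : ∀ k : Fin n → ℝ, (0, k) ∈ stableSubspace (hamiltonianMap A G Q) → Bᵀ *ᵥ k = 0 := by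
    intro k hk
    have h := symplecticForm_eq_zero_of_mem_stableSubspace
      (symplecticForm_hamiltonianMap (inputMatrix_transpose hR)
        (isHermitian_transpose_eq hQ.isHermitian)) hk (apply_mem_stableSubspace hk)
    refine transpose_mulVec_eq_zero_of_inputMatrix hR (R := R) ?_
    simpa [symplecticForm] using h
  have hAl : ∀ k : Fin n → ℝ, (0, k) ∈ stableSubspace (hamiltonianMap A G Q) →
      (0, Aᵀ *ᵥ k) ∈ stableSubspace (hamiltonianMap A G Q) := by
    intro k hk
    have h := Submodule.neg_mem _ (apply_mem_stableSubspace hk)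
    simpa [hG, inputMatrix_mulVec_eq_zero (R := R) (hBl k hk)] using h
  let N : Submodule ℝ (Fin n → ℝ) :=
    (stableSubspace (hamiltonianMap A G Q)).comap (LinearMap.inr ℝ (Fin n → ℝ) (Fin n → ℝ))
  -- The complexification of `N` is invariant under `Aᵀ`; were it nonzero, it would contain an
  -- eigenvector.
  let W : Submodule ℂ (Fin n → ℂ) :=
    { carrier := {w | vecRe _ w ∈ N ∧ vecIm _ w ∈ N}
      add_mem' := fun ha hb => by
        simp only [mem_ofPred_eq, map_add]
        exact ⟨N.add_mem ha.1 hb.1, N.add_mem ha.2 hb.2⟩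
      zero_mem' := by
        simp only [mem_ofPred_eq, map_zero]
        exact ⟨N.zero_mem, N.zero_mem⟩
      smul_mem' := fun c w hw => by
        simp only [mem_ofPred_eq, vecRe_smul, vecIm_smul]
        exact ⟨N.sub_mem (N.smul_mem _ hw.1) (N.smul_mem _ hw.2),
          N.add_mem (N.smul_mem _ hw.2) (N.smul_mem _ hw.1)⟩ }
  have hWA : ∀ w ∈ W, Aᵀ.complexify.mulVecLin w ∈ W := fun w hw =>
    ⟨by rw [mulVecLin_apply, vecRe_mulVec]; exact hAl _ hw.1,
      by rw [mulVecLin_apply, vecIm_mulVec]; exact hAl _ hw.2⟩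
  have hW : W = ⊥ := by
    by_contra hne
    have : Nontrivial W := Submodule.nontrivial_iff_ne_bot.2 hne
    obtain ⟨μ, hμ⟩ := Module.End.exists_eigenvalue (Aᵀ.complexify.mulVecLin.restrict hWA)
    obtain ⟨⟨w, hw⟩, hwμ, hw0⟩ := hμ.exists_hasEigenvector
    rw [Module.End.mem_eigenspace_iff] at hwμ
    have hAw : Aᵀ.complexify *ᵥ w = μ • w := congrArg Subtype.val hwμ
    have hBw : Bᵀ.complexify *ᵥ w = 0 := complex_mulVec_eq_zero (hBl _ hw.1) (hBl _ hw.2)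
    refine hw0 (Subtype.ext ?_)
    change w = 0
    rcases le_or_gt 0 μ.re with h0 | h0
    · exact hstab.eq_zero_of_vecMul h0
        (by rw [← mulVec_transpose, ← complexify_transpose, hAw])
        (by rw [← mulVec_transpose, ← complexify_transpose, hBw])
    -- Here `(0, w)` is an eigenvector of the Hamiltonian map for `-μ`, whose real part is positive,
    -- so it cannot be stable.
    · let T := hamiltonianMap A.complexify G.complexify Q.complexify
      have hT : T (0, w) = (-μ) • (0, w) := by
        have : G.complexify *ᵥ w = 0 := by
          rw [hG, complexify_mul, ← mulVec_mulVec, hBw, mulVec_zero]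
        simp [T, this, ← complexify_transpose, hAw]
      have hι : ∀ k ∈ N, ((0 : Fin n → ℂ), vecOfReal _ k) ∈
          stableSubspace (T.restrictScalars ℝ) := fun k hk => by
        have := map_mem_stableSubspace (ι := (vecOfReal (Fin n)).prodMap (vecOfReal (Fin n)))
          (T := T.restrictScalars ℝ) (vecOfReal_hamiltonianMap A G Q)
          (v := ((0 : Fin n → ℝ), k)) hk
        simpa using this
      have hI : ((0 : Fin n → ℂ), Complex.I • vecOfReal _ (vecIm _ w)) ∈
          stableSubspace (T.restrictScalars ℝ) := by
        have := smul_mem_stableSubspace_restrictScalars Complex.I (hι _ hw.2)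
        rwa [Prod.smul_mk, smul_zero] at this
      have hmem := Submodule.add_mem _ (hι _ hw.1) hI
      rw [Prod.mk_add_mk, add_zero, vecOfReal_add_I_smul] at hmem
      have := eq_zero_of_eigenvector_mem_stableSubspace (by simpa using h0.le) hT hmem
      exact congrArg Prod.snd this
  have hmem : vecOfReal _ l ∈ W := by
    have him : vecIm (Fin n) (vecOfReal _ l) = 0 := by ext; simp
    refine ⟨by rw [vecRe_vecOfReal]; exact hl, by rw [him]; exact N.zero_mem⟩
  rw [hW, Submodule.mem_bot] at hmem
  rw [← vecRe_vecOfReal l, hmem, map_zero]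

/-- On the stable subspace of the Hamiltonian map the form `x ⬝ l` is nonnegative. -/
theorem dotProduct_nonneg_of_mem_stableSubspace_hamiltonianMap (hQ : Q.PosSemidef) (hR : R.PosDef)
    {v : (Fin n → ℝ) × (Fin n → ℝ)}
    (hv : v ∈ stableSubspace (hamiltonianMap A (B * R⁻¹ * Bᵀ) Q)) : 0 ≤ v.1 ⬝ᵥ v.2 := by
  let L := hamiltonianMap A (B * R⁻¹ * Bᵀ) Q
  let g : ℝ → ℝ := fun t => (NormedSpace.exp (t • L) v).1 ⬝ᵥ (NormedSpace.exp (t • L) v).2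
  -- Along the flow the derivative of `x ⬝ l` is `-(x ⬝ Q x) - l ⬝ G l` with `G = B R⁻¹ Bᵀ`; a
  -- nonincreasing function with limit zero is nonnegative.
  have hg : ∀ t, ∃ c ≤ 0, HasDerivAt g c t := fun t => by
    have h1 := hasDerivAt_flow L v t
    refine ⟨_, ?_, h1.prod_fst.dotProduct h1.prod_snd⟩
    set z := NormedSpace.exp (t • L) v
    have q := posSemidef_nonneg hQ z.1
    have r := inputMatrix_nonneg (B := B) hR z.2
    have h3 : z.1 ⬝ᵥ Aᵀ *ᵥ z.2 = (A *ᵥ z.1) ⬝ᵥ z.2 := by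
      rw [dotProduct_mulVec, vecMul_transpose]
    simp only [L, hamiltonianMap_apply, sub_dotProduct, dotProduct_sub, dotProduct_neg]
    rw [dotProduct_comm _ z.2] at *
    linarith [dotProduct_comm ((B * R⁻¹ * Bᵀ) *ᵥ z.2) z.2]
  have hanti : Antitone g := antitone_of_deriv_nonpos
    (fun t => (hg t).choose_spec.2.differentiableAt)
    (fun t => (hg t).choose_spec.2.deriv.trans_le (hg t).choose_spec.1)
  have hlim : Tendsto g atTop (𝓝 0) := by
    have hv' := (Prod.tendsto_iff _ _).1 (mem_stableSubspace.1 hv)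
    exact tendsto_dotProduct_zero hv'.1 hv'.2
  have h0 := hanti.le_of_tendsto hlim 0
  simpa [g, NormedSpace.exp_zero] using h0

theorem exists_isRiccatiSolution (hQ : Q.PosSemidef) (hR : R.PosDef)
    (hstab : IsStabilizable A B) (hdet : IsDetectable A Q) :
    ∃ P, IsRiccatiSolution A B Q R P := by
  set G := B * R⁻¹ * Bᵀ with hG
  have hGt : Gᵀ = G := inputMatrix_transpose hR
  have hQt := isHermitian_transpose_eq hQ.isHermitian
  set V := stableSubspace (hamiltonianMap A G Q) with hV
  have hiso : ∀ a ∈ V, ∀ b ∈ V, symplecticForm a b = 0 := fun a ha b hb =>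
    symplecticForm_eq_zero_of_mem_stableSubspace (symplecticForm_hamiltonianMap hGt hQt) ha hb
  have hiso' : ∀ a ∈ stableSubspace (-hamiltonianMap A G Q),
      ∀ b ∈ stableSubspace (-hamiltonianMap A G Q), symplecticForm a b = 0 := fun a ha b hb =>
    symplecticForm_eq_zero_of_mem_stableSubspace (fun a b => by
      have := symplecticForm_hamiltonianMap (A := A) hGt hQt a b
      simp only [symplecticForm, _root_.neg_apply, Prod.fst_neg, Prod.snd_neg,
        neg_dotProduct, dotProduct_neg] at this ⊢
      linarith) ha hb
  have hsup : V ⊔ stableSubspace (-hamiltonianMap A G Q) = ⊤ :=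
    stableSubspace_hamiltonianMap_sup hQ hR hstab hdet
  let π : V →ₗ[ℝ] (Fin n → ℝ) := LinearMap.fst ℝ _ _ ∘ₗ V.subtype
  have hinj : Function.Injective π := by
    rw [injective_iff_map_eq_zero]
    rintro ⟨⟨x, l⟩, hxl⟩ (rfl : x = 0)
    have hl : l = 0 := eq_zero_of_mem_stableSubspace_hamiltonianMap hQ hR hstab hxl
    exact Subtype.ext (Prod.ext rfl hl)
  -- A `w` orthogonal to the projection of `V` makes `(0, w)` symplectically orthogonal to `V`.
  -- Write `(0, w) = a + b` with `a` forward and `b` backward stable: then `b` is orthogonal to both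
  -- subspaces, so `b = 0` by nondegeneracy, and `(0, w) = a ∈ V` forces `w = 0`.
  have hsurj : Function.Surjective π := by
    rw [← LinearMap.range_eq_top]
    by_contra hne
    obtain ⟨f, hf0, hf⟩ := Submodule.exists_le_ker_of_lt_top _ (lt_top_iff_ne_top.2 hne)
    obtain ⟨w, hw⟩ : ∃ w : Fin n → ℝ, ∀ x, f x = w ⬝ᵥ x :=
      ⟨fun i => f (fun j => if i = j then 1 else 0), fun x => by
        rw [LinearMap.pi_apply_eq_sum_univ f x]
        simp [dotProduct, mul_comm]⟩
    have hwV : ∀ c ∈ V, w ⬝ᵥ c.1 = 0 := fun c hc => by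
      rw [← hw]
      exact hf ⟨⟨c, hc⟩, rfl⟩
    obtain ⟨a, ha, b, hb, hab⟩ := Submodule.mem_sup.1
      (hsup ▸ Submodule.mem_top : ((0 : Fin n → ℝ), w) ∈ V ⊔ _)
    have hadd : ∀ a b c : (Fin n → ℝ) × (Fin n → ℝ),
        symplecticForm (a + b) c = symplecticForm a c + symplecticForm b c := fun a b c => by
      simp only [symplecticForm, Prod.fst_add, Prod.snd_add, add_dotProduct]; ring
    have hadd' : ∀ a b c : (Fin n → ℝ) × (Fin n → ℝ),
        symplecticForm c (a + b) = symplecticForm c a + symplecticForm c b := fun a b c => by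
      simp only [symplecticForm, Prod.fst_add, Prod.snd_add, dotProduct_add]; ring
    have hbV : ∀ c ∈ V, symplecticForm b c = 0 := fun c hc => by
      have h1 := hadd a b c
      rw [hab, hiso a ha c hc, zero_add] at h1
      rw [← h1]
      simp [symplecticForm, hwV c hc]
    have hb0 : ∀ c, symplecticForm b c = 0 := fun c => by
      obtain ⟨c₁, hc₁, c₂, hc₂, rfl⟩ := Submodule.mem_sup.1
        (hsup ▸ Submodule.mem_top : c ∈ V ⊔ _)
      rw [hadd', hbV c₁ hc₁, hiso' b hb c₂ hc₂, add_zero]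
    have hb1 : b = 0 := by
      refine Prod.ext (dotProduct_eq _ _ fun u => ?_) (dotProduct_eq _ _ fun u => ?_)
      · simpa [symplecticForm] using hb0 (0, u)
      · simpa [symplecticForm] using hb0 (u, 0)
    rw [hb1, add_zero] at hab
    have hw0 : w = 0 := eq_zero_of_mem_stableSubspace_hamiltonianMap hQ hR hstab (hab ▸ ha)
    exact hf0 (LinearMap.ext fun x => by simp [hw, hw0])
  let e := LinearEquiv.ofBijective π ⟨hinj, hsurj⟩
  let p : (Fin n → ℝ) →ₗ[ℝ] (Fin n → ℝ) := LinearMap.snd ℝ _ _ ∘ₗ V.subtype ∘ₗ e.symm.toLinearMap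
  set P := LinearMap.toMatrix' p with hP
  have hPV : ∀ x, (x, P *ᵥ x) ∈ V := fun x => by
    have h1 : (e.symm x : (Fin n → ℝ) × (Fin n → ℝ)).1 = x := e.apply_symm_apply x
    have h2 : P *ᵥ x = (e.symm x : (Fin n → ℝ) × (Fin n → ℝ)).2 := by
      rw [hP, LinearMap.toMatrix'_mulVec]; rfl
    rw [h2]
    nth_rewrite 1 [← h1]
    exact (e.symm x).2
  have hPsymm : Pᵀ = P := by
    refine ext_of_mulVec_single fun i => dotProduct_eq _ _ fun u => ?_
    have := hiso _ (hPV (Pi.single i 1)) _ (hPV u)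
    simp only [symplecticForm] at this
    rw [← sub_eq_zero, mulVec_transpose, ← dotProduct_mulVec, this]
  refine ⟨P, ?_, ?_⟩
  · refine PosSemidef.of_dotProduct_mulVec_nonneg ?_ fun x => ?_
    · rw [IsHermitian, conjTranspose_eq_transpose_of_trivial, hPsymm]
    · simpa using dotProduct_nonneg_of_mem_stableSubspace_hamiltonianMap hQ hR (hPV x)
  · refine ext_of_mulVec_single fun i => ?_
    set x : Fin n → ℝ := Pi.single i 1
    -- The image of `(x, P x)` stays in `V`. Subtracting the graph point over its first component
    -- leaves `(0, r)`, where `r` is minus the Riccati residual applied to `x`.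
    have h1 := apply_mem_stableSubspace (hPV x)
    have h2 := V.sub_mem h1 (hPV (A *ᵥ x - G *ᵥ (P *ᵥ x)))
    rw [hamiltonianMap_apply, Prod.mk_sub_mk, sub_self] at h2
    have h3 := eq_zero_of_mem_stableSubspace_hamiltonianMap hQ hR hstab h2
    rw [mulVec_sub] at h3
    have hPG : P * B * R⁻¹ * Bᵀ * P = P * (G * P) := by simp only [hG, Matrix.mul_assoc]
    rw [hPG, zero_mulVec, add_mulVec, sub_mulVec, add_mulVec, ← neg_eq_zero, ← h3]
    simp only [mulVec_mulVec]
    abel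

/-- The Lyapunov identity of a Riccati solution. -/
theorem IsRiccatiSolution.two_mul_dotProduct {P : Matrix (Fin n) (Fin n) ℝ}
    (hP : IsRiccatiSolution A B Q R P) (x : Fin n → ℝ) :
    2 * ((P *ᵥ x) ⬝ᵥ (A - B * feedbackGain B R P) *ᵥ x) =
      -(x ⬝ᵥ Q *ᵥ x) - (P *ᵥ x) ⬝ᵥ (B * R⁻¹ * Bᵀ) *ᵥ (P *ᵥ x) := by
  have hPt := isHermitian_transpose_eq hP.1.isHermitian
  have h := congrArg (fun M => x ⬝ᵥ M *ᵥ x) hP.2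
  have hPG : P * B * R⁻¹ * Bᵀ * P = P * ((B * R⁻¹ * Bᵀ) * P) := by simp only [Matrix.mul_assoc]
  have hBK : B * feedbackGain B R P = (B * R⁻¹ * Bᵀ) * P := by
    simp only [feedbackGain, Matrix.mul_assoc]
  simp only [hPG, add_mulVec, sub_mulVec, ← mulVec_mulVec, dotProduct_add, dotProduct_sub,
    zero_mulVec, dotProduct_zero, dotProduct_mulVec_comm_of_transpose_eq hPt,
    dotProduct_mulVec x Aᵀ, vecMul_transpose] at h
  rw [← dotProduct_mulVec_comm_of_transpose_eq hPt (A *ᵥ x) x, dotProduct_comm (A *ᵥ x)] at h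
  simp only [hBK, sub_mulVec, ← mulVec_mulVec, dotProduct_sub]
  linarith

/-- The closed-loop matrix of a Riccati solution is Hurwitz. -/
theorem IsRiccatiSolution.eq_zero_of_mulVec_eq_smul (hQ : Q.PosSemidef) (hR : R.PosDef)
    (hdet : IsDetectable A Q) {P : Matrix (Fin n) (Fin n) ℝ} (hP : IsRiccatiSolution A B Q R P)
    {μ : ℂ} (hμ : 0 ≤ μ.re) {w : Fin n → ℂ}
    (hw : (A - B * feedbackGain B R P).complexify *ᵥ w = μ • w) : w = 0 := by
  have hr := congrArg (vecRe _) hw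
  have hi := congrArg (vecIm _) hw
  rw [vecRe_mulVec, vecRe_smul] at hr
  rw [vecIm_mulVec, vecIm_smul] at hi
  -- Adding the Lyapunov identities for the real and imaginary parts cancels the terms in `μ.im`.
  -- The left side is then nonnegative and the right side nonpositive, so `Q w = 0` and `B K w = 0`;
  -- hence `A w = μ w` and detectability applies.
  have e1 := hP.two_mul_dotProduct (vecRe _ w)
  have e2 := hP.two_mul_dotProduct (vecIm _ w)
  rw [hr, dotProduct_sub, dotProduct_smul, dotProduct_smul] at e1
  rw [hi, dotProduct_add, dotProduct_smul, dotProduct_smul] at e2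
  have hPt := isHermitian_transpose_eq hP.1.isHermitian
  set a := vecRe _ w
  set b := vecIm _ w
  have hab : (P *ᵥ b) ⬝ᵥ a = (P *ᵥ a) ⬝ᵥ b := by
    rw [dotProduct_comm, dotProduct_mulVec_comm_of_transpose_eq hPt]
  have pa := posSemidef_nonneg hP.1 a
  have pb := posSemidef_nonneg hP.1 b
  rw [dotProduct_comm] at pa pb
  have qa := posSemidef_nonneg hQ a
  have qb := posSemidef_nonneg hQ b
  have ga := inputMatrix_nonneg (B := B) hR (P *ᵥ a)
  have gb := inputMatrix_nonneg (B := B) hR (P *ᵥ b)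
  have ma := mul_nonneg hμ pa
  have mb := mul_nonneg hμ pb
  rw [hab] at e2
  simp only [smul_eq_mul] at e1 e2
  have hQw : Q.complexify *ᵥ w = 0 := complex_mulVec_eq_zero
    (posSemidef_mulVec_eq_zero hQ (by linarith)) (posSemidef_mulVec_eq_zero hQ (by linarith))
  have hKw : (B * feedbackGain B R P).complexify *ᵥ w = 0 := by
    have hBK : B * feedbackGain B R P = (B * R⁻¹ * Bᵀ) * P := by
      simp only [feedbackGain, Matrix.mul_assoc]
    refine complex_mulVec_eq_zero ?_ ?_ <;> rw [hBK, ← mulVec_mulVec] <;>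
      refine inputMatrix_mulVec_eq_zero (transpose_mulVec_eq_zero_of_inputMatrix hR ?_) <;>
      linarith
  refine hdet.eq_zero_of_mulVec hμ ?_ hQw
  have hsub : (A - B * feedbackGain B R P).complexify *ᵥ w =
      A.complexify *ᵥ w - (B * feedbackGain B R P).complexify *ᵥ w := by
    rw [← sub_mulVec]
    congr 1
    ext; simp
  rw [← hw, hsub, hKw, sub_zero]

theorem IsRiccatiSolution.stableSubspace_eq_top (hQ : Q.PosSemidef) (hR : R.PosDef)
    (hdet : IsDetectable A Q) {P : Matrix (Fin n) (Fin n) ℝ} (hP : IsRiccatiSolution A B Q R P) :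
    stableSubspace (LinearMap.toContinuousLinearMap
      (A - B * feedbackGain B R P).mulVecLin) = ⊤ :=
  stableSubspace_eq_top_of_complexification (ι := vecOfReal _) (ρ := vecRe _)
    (T := LinearMap.toContinuousLinearMap (A - B * feedbackGain B R P).complexify.mulVecLin)
    vecRe_vecOfReal (fun w => vecRe_mulVec _ w)
    fun _ _ hμ hw => hP.eq_zero_of_mulVec_eq_smul hQ hR hdet hμ hw

/-- The Riccati equation says exactly that `x ↦ (x, P x)` intertwines `A - B K` with the Hamiltonian
map, and every orbit of `A - B K` tends to zero. -/
theorem IsRiccatiSolution.mem_stableSubspace_hamiltonianMap (hQ : Q.PosSemidef) (hR : R.PosDef)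
    (hdet : IsDetectable A Q) {P : Matrix (Fin n) (Fin n) ℝ} (hP : IsRiccatiSolution A B Q R P)
    (x : Fin n → ℝ) : (x, P *ᵥ x) ∈ stableSubspace (hamiltonianMap A (B * R⁻¹ * Bᵀ) Q) := by
  have hx : x ∈ stableSubspace (LinearMap.toContinuousLinearMap
      (A - B * feedbackGain B R P).mulVecLin) := by
    rw [hP.stableSubspace_eq_top hQ hR hdet]; trivial
  refine map_mem_stableSubspace (ι := (ContinuousLinearMap.id ℝ _).prod
    (LinearMap.toContinuousLinearMap P.mulVecLin)) (fun v => ?_) hx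
  have h := congrArg (· *ᵥ v) hP.2
  have hPG : P * B * R⁻¹ * Bᵀ * P = P * ((B * R⁻¹ * Bᵀ) * P) := by simp only [Matrix.mul_assoc]
  have hBK : B * feedbackGain B R P = (B * R⁻¹ * Bᵀ) * P := by
    simp only [feedbackGain, Matrix.mul_assoc]
  simp only [hPG, add_mulVec, sub_mulVec, zero_mulVec, ← mulVec_mulVec] at h
  change ((A - B * feedbackGain B R P) *ᵥ v, P *ᵥ ((A - B * feedbackGain B R P) *ᵥ v)) =
    (A *ᵥ v - (B * R⁻¹ * Bᵀ) *ᵥ (P *ᵥ v), -(Q *ᵥ v) - Aᵀ *ᵥ (P *ᵥ v))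
  rw [hBK, sub_mulVec, ← mulVec_mulVec, mulVec_sub, Prod.mk.injEq]
  simp only [← mulVec_mulVec] at h ⊢
  refine ⟨trivial, ?_⟩
  rw [← sub_eq_zero, ← h]
  abel

theorem existsUnique_isRiccatiSolution (hQ : Q.PosSemidef) (hR : R.PosDef)
    (hstab : IsStabilizable A B) (hdet : IsDetectable A Q) :
    ∃! P, IsRiccatiSolution A B Q R P := by
  obtain ⟨P, hP⟩ := exists_isRiccatiSolution hQ hR hstab hdet
  refine ⟨P, hP, fun P' hP' => ext_of_mulVec_single fun i => ?_⟩
  have h := Submodule.sub_mem _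
    (hP'.mem_stableSubspace_hamiltonianMap hQ hR hdet (Pi.single i 1))
    (hP.mem_stableSubspace_hamiltonianMap hQ hR hdet (Pi.single i 1))
  rw [Prod.mk_sub_mk, sub_self] at h
  exact sub_eq_zero.1 (eq_zero_of_mem_stableSubspace_hamiltonianMap hQ hR hstab h)

end Riccati

/-! ### Steady-state optimization -/

section SteadyState

variable {n m p : ℕ} {A : Matrix (Fin n) (Fin n) ℝ} {B : Matrix (Fin n) (Fin m) ℝ}
  {C : Matrix (Fin n) (Fin p) ℝ} {d : Fin p → ℝ} {Q : Matrix (Fin n) (Fin n) ℝ}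
  {R : Matrix (Fin m) (Fin m) ℝ} {Ky Kl : Matrix (Fin n) (Fin n) ℝ}

theorem primalDualMatrix_complexify_mulVec (y l : Fin n → ℂ) :
    (primalDualMatrix A B Q R Ky Kl).complexify *ᵥ Sum.elim y l =
      Sum.elim (-(Ky.complexify *ᵥ (Q.complexify *ᵥ y + Aᵀ.complexify *ᵥ l)))
        (Kl.complexify *ᵥ (A.complexify *ᵥ y - (B * R⁻¹ * Bᵀ).complexify *ᵥ l)) := by
  have hneg : ∀ M : Matrix (Fin n) (Fin n) ℝ, (-M).complexify = -M.complexify := fun M => by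
    ext; simp
  have hzero : (0 : Matrix (Fin n) (Fin n) ℝ).complexify = 0 := by ext; simp
  rw [primalDualMatrix, complexify_mul, ← mulVec_mulVec]
  simp only [Matrix.complexify, fromBlocks_map] at hneg hzero ⊢
  rw [fromBlocks_mulVec, fromBlocks_mulVec]
  simp only [hneg, hzero, Sum.elim_comp_inl, Sum.elim_comp_inr, neg_mulVec, zero_mulVec, add_zero,
    zero_add]
  rw [← neg_add, mulVec_neg, sub_eq_add_neg]

/-- The map `(y, l) ↦ (Q y + Aᵀ l, A y - B R⁻¹ Bᵀ l)` is injective. -/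
theorem eq_zero_of_kkt (hS : IsHurwitz (primalDualMatrix A B Q R Ky Kl)) {y l : Fin n → ℝ}
    (h1 : Q *ᵥ y + Aᵀ *ᵥ l = 0) (h2 : A *ᵥ y - (B * R⁻¹ * Bᵀ) *ᵥ l = 0) : y = 0 ∧ l = 0 := by
  -- A pair in the kernel, if nonzero, would be an eigenvector of `S` for the eigenvalue `0`.
  have h := hS.eq_zero_of_mulVec_eq_smul (μ := 0) le_rfl
    (w := Sum.elim (vecOfReal _ y) (vecOfReal _ l)) (by
      rw [primalDualMatrix_complexify_mulVec]
      simp only [← vecOfReal_mulVec, ← map_add, ← map_sub, h1, h2]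
      ext (i | i) <;> simp)
  constructor
  · rw [← vecRe_vecOfReal y, show vecOfReal _ y = 0 from funext fun i => congrFun h (Sum.inl i),
      map_zero]
  · rw [← vecRe_vecOfReal l, show vecOfReal _ l = 0 from funext fun i => congrFun h (Sum.inr i),
      map_zero]

theorem exists_kkt (hS : IsHurwitz (primalDualMatrix A B Q R Ky Kl)) (b : Fin n → ℝ) :
    ∃ y l : Fin n → ℝ, Q *ᵥ y + Aᵀ *ᵥ l = 0 ∧ A *ᵥ y - (B * R⁻¹ * Bᵀ) *ᵥ l = b := by
  let f : (Fin n → ℝ) × (Fin n → ℝ) →ₗ[ℝ] (Fin n → ℝ) × (Fin n → ℝ) :=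
    (Q.mulVecLin ∘ₗ LinearMap.fst ℝ _ _ + Aᵀ.mulVecLin ∘ₗ LinearMap.snd ℝ _ _).prod
      (A.mulVecLin ∘ₗ LinearMap.fst ℝ _ _ - (B * R⁻¹ * Bᵀ).mulVecLin ∘ₗ LinearMap.snd ℝ _ _)
  have hf : Function.Injective f := by
    rw [injective_iff_map_eq_zero]
    intro v hv
    obtain ⟨h1, h2⟩ := eq_zero_of_kkt hS (congrArg Prod.fst hv) (congrArg Prod.snd hv)
    exact Prod.ext h1 h2
  obtain ⟨v, hv⟩ := LinearMap.surjective_of_injective hf (0, b)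
  exact ⟨v.1, v.2, congrArg Prod.fst hv, congrArg Prod.snd hv⟩

theorem eq_neg_mulVec_of_isMultiplier (hR : R.PosDef) {y l : Fin n → ℝ} {u : Fin m → ℝ}
    (h : IsMultiplier A B C Q R d y u l) : u = -((R⁻¹ * Bᵀ) *ᵥ l) := by
  have hdet : IsUnit R.det := (Matrix.isUnit_iff_isUnit_det R).1 hR.isUnit
  have h1 := congrArg (R⁻¹ *ᵥ ·) h.2.1
  simp only [mulVec_add, mulVec_mulVec, nonsing_inv_mul _ hdet, one_mulVec, mulVec_zero] at h1
  exact eq_neg_of_add_eq_zero_left h1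

theorem exists_isMultiplier (hR : R.PosDef) (hS : IsHurwitz (primalDualMatrix A B Q R Ky Kl)) :
    ∃ (y : Fin n → ℝ) (u : Fin m → ℝ) (l : Fin n → ℝ), IsMultiplier A B C Q R d y u l := by
  obtain ⟨y, l, h1, h2⟩ := exists_kkt hS (-(C *ᵥ d))
  have hdet : IsUnit R.det := (Matrix.isUnit_iff_isUnit_det R).1 hR.isUnit
  refine ⟨y, -((R⁻¹ * Bᵀ) *ᵥ l), l, h1, ?_, ?_⟩
  · rw [mulVec_neg, mulVec_mulVec, ← Matrix.mul_assoc, mul_nonsing_inv _ hdet, Matrix.one_mul,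
      neg_add_cancel]
  · rw [plant, mulVec_neg, mulVec_mulVec, ← Matrix.mul_assoc, ← sub_eq_add_neg, h2,
      neg_add_cancel]

/-- The cost of a feasible pair exceeds the cost of a KKT pair by the cost of the difference. -/
theorem cost_eq_add_cost_sub (hQ : Q.PosSemidef) (hR : R.PosDef) {y l : Fin n → ℝ}
    {u : Fin m → ℝ} (h : IsMultiplier A B C Q R d y u l) {y' : Fin n → ℝ} {u' : Fin m → ℝ}
    (h' : plant A B C d y' u' = 0) :
    cost Q R y' u' = cost Q R y u + cost Q R (y' - y) (u' - u) := by
  obtain ⟨h1, h2, h3⟩ := h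
  have hQt := isHermitian_transpose_eq hQ.isHermitian
  have hRt := isHermitian_transpose_eq hR.isHermitian
  have hfeas : A *ᵥ (y' - y) + B *ᵥ (u' - u) = 0 := by
    rw [← sub_self (0 : Fin n → ℝ)]
    nth_rewrite 1 [← h']
    rw [← h3, plant, plant, mulVec_sub, mulVec_sub]
    abel
  -- The KKT conditions make the gradient of the cost orthogonal to every feasible direction, so the
  -- cross term of the quadratic expansion vanishes.
  have hgrad : (y' - y) ⬝ᵥ Q *ᵥ y + (u' - u) ⬝ᵥ R *ᵥ u = 0 := by
    rw [eq_neg_of_add_eq_zero_left h1, eq_neg_of_add_eq_zero_left h2, dotProduct_neg,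
      dotProduct_neg, dotProduct_mulVec, dotProduct_mulVec, vecMul_transpose, vecMul_transpose,
      ← neg_add, ← add_dotProduct, hfeas, zero_dotProduct, neg_zero]
  have e1 : y ⬝ᵥ Q *ᵥ y' = y' ⬝ᵥ Q *ᵥ y := by
    rw [dotProduct_mulVec_comm_of_transpose_eq hQt, dotProduct_comm]
  have e2 : u ⬝ᵥ R *ᵥ u' = u' ⬝ᵥ R *ᵥ u := by
    rw [dotProduct_mulVec_comm_of_transpose_eq hRt, dotProduct_comm]
  simp only [cost, mulVec_sub, sub_dotProduct, dotProduct_sub] at hgrad ⊢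
  linarith

theorem cost_nonneg (hQ : Q.PosSemidef) (hR : R.PosDef) (y : Fin n → ℝ) (u : Fin m → ℝ) :
    0 ≤ cost Q R y u := by
  have h1 := posSemidef_nonneg hQ y
  have h2 := posSemidef_nonneg hR.posSemidef u
  rw [cost]; linarith

theorem isOptimalSteadyState_of_isMultiplier (hQ : Q.PosSemidef) (hR : R.PosDef)
    {y l : Fin n → ℝ} {u : Fin m → ℝ} (h : IsMultiplier A B C Q R d y u l) :
    IsOptimalSteadyState A B C Q R d (y, u) :=
  ⟨h.2.2, fun y' u' h' => by
    rw [cost_eq_add_cost_sub hQ hR h h']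
    exact le_add_of_nonneg_right (cost_nonneg hQ hR _ _)⟩

/-- Strict convexity holds only in `u`, as `Q` is merely semidefinite. Equal costs give `u' = u` and
`Q (y' - y) = 0`, then feasibility gives `A (y' - y) = 0`, so `(y' - y, 0)` lies in the trivial KKT
kernel. -/
theorem eq_of_isOptimalSteadyState (hQ : Q.PosSemidef) (hR : R.PosDef)
    (hS : IsHurwitz (primalDualMatrix A B Q R Ky Kl)) {y l : Fin n → ℝ} {u : Fin m → ℝ}
    (h : IsMultiplier A B C Q R d y u l) {w : (Fin n → ℝ) × (Fin m → ℝ)}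
    (hw : IsOptimalSteadyState A B C Q R d w) : w = (y, u) := by
  obtain ⟨y', u'⟩ := w
  have hle := hw.2 y u h.2.2
  rw [cost_eq_add_cost_sub hQ hR h hw.1] at hle
  unfold cost at hle
  have q := posSemidef_nonneg hQ (y' - y)
  have r := posSemidef_nonneg hR.posSemidef (u' - u)
  have hu : u' - u = 0 := posDef_eq_zero hR (by linarith)
  have hy := posSemidef_mulVec_eq_zero hQ (x := y' - y) (by linarith)
  obtain rfl := sub_eq_zero.1 hu
  have hAy : A *ᵥ (y' - y) = 0 := by
    have h1 := hw.1
    have h2 := h.2.2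
    simp only [plant] at h1 h2
    rw [mulVec_sub, ← sub_self (0 : Fin n → ℝ)]
    nth_rewrite 1 [← h1]
    rw [← h2]
    abel
  have := (eq_zero_of_kkt hS (y := y' - y) (l := 0) (by simp [hy]) (by simp [hAy])).1
  rw [sub_eq_zero.1 this]

theorem existsUnique_isOptimalSteadyState (hQ : Q.PosSemidef) (hR : R.PosDef)
    (hS : IsHurwitz (primalDualMatrix A B Q R Ky Kl)) :
    ∃! w : (Fin n → ℝ) × (Fin m → ℝ), IsOptimalSteadyState A B C Q R d w := by
  obtain ⟨y, u, l, h⟩ := exists_isMultiplier (C := C) (d := d) hR hS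
  exact ⟨(y, u), isOptimalSteadyState_of_isMultiplier hQ hR h,
    fun w hw => eq_of_isOptimalSteadyState hQ hR hS h hw⟩

theorem existsUnique_isMultiplier (hQ : Q.PosSemidef) (hR : R.PosDef)
    (hS : IsHurwitz (primalDualMatrix A B Q R Ky Kl)) {x : Fin n → ℝ} {u : Fin m → ℝ}
    (h : IsOptimalSteadyState A B C Q R d (x, u)) :
    ∃! l : Fin n → ℝ, IsMultiplier A B C Q R d x u l := by
  obtain ⟨y, v, l, hl⟩ := exists_isMultiplier (C := C) (d := d) hR hS
  obtain ⟨rfl, rfl⟩ := Prod.mk.inj (eq_of_isOptimalSteadyState hQ hR hS hl h)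
  refine ⟨l, hl, fun k hk => ?_⟩
  have h1 : Q *ᵥ (0 : Fin n → ℝ) + Aᵀ *ᵥ (k - l) = 0 := by
    rw [mulVec_zero, zero_add, mulVec_sub, eq_neg_of_add_eq_zero_right hk.1,
      eq_neg_of_add_eq_zero_right hl.1, sub_self]
  have h2 : Bᵀ *ᵥ (k - l) = 0 := by
    rw [mulVec_sub, eq_neg_of_add_eq_zero_right hk.2.1,
      eq_neg_of_add_eq_zero_right hl.2.1, sub_self]
  exact sub_eq_zero.1 (eq_zero_of_kkt hS h1
    (by rw [inputMatrix_mulVec_eq_zero h2, mulVec_zero, sub_self])).2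

end SteadyState

/-! ### The closed loops -/

section ClosedLoop

/-- A zero of `f` is a constant solution, which must converge to `e`. -/
theorem IsAsymptoticallyStable.eq_of_apply_eq_zero {E : Type*} [NormedAddCommGroup E]
    [NormedSpace ℝ E] {f : E → E} {e : E} (h : IsAsymptoticallyStable f e) {z : E}
    (hz : f z = 0) : z = e := by
  refine tendsto_nhds_unique tendsto_const_nhds (h.attractive (fun _ => z) fun t _ => ?_)
  have := hasDerivWithinAt_const t (Ici (0 : ℝ)) z
  rwa [← hz] at this

/-- The image of a solution under a linear change of coordinates. -/
theorem IsSolution.map {E F : Type*} [NormedAddCommGroup E] [NormedSpace ℝ E]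
    [NormedAddCommGroup F] [NormedSpace ℝ F] {f : E → E} {g : F → F} {Φ : E →L[ℝ] F}
    (hg : ∀ z, g (Φ z) = Φ (f z)) {z : ℝ → E} (hz : IsSolution f z) :
    IsSolution g (fun t => Φ (z t)) := fun t ht => by
  have := Φ.hasFDerivAt.comp_hasDerivWithinAt t (hz t ht)
  rwa [← hg] at this

/-- Asymptotic stability is invariant under linear changes of coordinates. -/
theorem IsAsymptoticallyStable.conj {E F : Type*} [NormedAddCommGroup E] [NormedSpace ℝ E]
    [NormedAddCommGroup F] [NormedSpace ℝ F] {f : E → E} {g : F → F} {e : E}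
    (h : IsAsymptoticallyStable f e) (Φ : E ≃L[ℝ] F) (hg : ∀ z, g (Φ z) = Φ (f z)) :
    IsAsymptoticallyStable g (Φ e) where
  equilibrium := by rw [hg, h.equilibrium, map_zero]
  exists_solution := fun w₀ => by
    obtain ⟨z, hz0, hz⟩ := h.exists_solution (Φ.symm w₀)
    exact ⟨fun t => Φ (z t), by simp only [hz0, Φ.apply_symm_apply],
      hz.map (Φ := (Φ : E →L[ℝ] F)) hg⟩
  stable := fun ε hε => by
    have hpull : ∀ w, f (Φ.symm w) = Φ.symm (g w) := fun w => by
      rw [Φ.eq_symm_apply, ← hg, Φ.apply_symm_apply]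
    have hΦ : 0 < ‖(Φ : E →L[ℝ] F)‖ + 1 := by positivity
    have hΨ : 0 < ‖(Φ.symm : F →L[ℝ] E)‖ + 1 := by positivity
    obtain ⟨δ, hδ, hst⟩ := h.stable (ε / (‖(Φ : E →L[ℝ] F)‖ + 1)) (by positivity)
    refine ⟨δ / (‖(Φ.symm : F →L[ℝ] E)‖ + 1), by positivity, fun w hw h0 t ht => ?_⟩
    have h1 := hst (fun t => Φ.symm (w t)) (hw.map (Φ := (Φ.symm : F →L[ℝ] E)) hpull) (by
      calc ‖Φ.symm (w 0) - e‖ = ‖(Φ.symm : F →L[ℝ] E) (w 0 - Φ e)‖ := by simp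
        _ ≤ ‖(Φ.symm : F →L[ℝ] E)‖ * ‖w 0 - Φ e‖ := ContinuousLinearMap.le_opNorm _ _
        _ ≤ (‖(Φ.symm : F →L[ℝ] E)‖ + 1) * ‖w 0 - Φ e‖ := by gcongr; linarith
        _ < _ := by rwa [lt_div_iff₀' hΨ] at h0) t ht
    calc ‖w t - Φ e‖ = ‖(Φ : E →L[ℝ] F) (Φ.symm (w t) - e)‖ := by simp
      _ ≤ ‖(Φ : E →L[ℝ] F)‖ * ‖Φ.symm (w t) - e‖ := ContinuousLinearMap.le_opNorm _ _
      _ ≤ (‖(Φ : E →L[ℝ] F)‖ + 1) * ‖Φ.symm (w t) - e‖ := by gcongr; linarith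
      _ < ε := by rwa [lt_div_iff₀' hΦ] at h1
  attractive := fun w hw => by
    have hpull : ∀ w, f (Φ.symm w) = Φ.symm (g w) := fun w => by
      rw [Φ.eq_symm_apply, ← hg, Φ.apply_symm_apply]
    have h1 := h.attractive _ (hw.map (Φ := (Φ.symm : F →L[ℝ] E)) hpull)
    have h2 := (Φ.continuous.tendsto e).comp h1
    simpa [Function.comp_def] using h2

/-- The linear part of the closed loop,
`(x, y, l) ↦ (A x - N (x - y) - G l, -K₁ (Q y + Aᵀ l), K₂ (A y - G l))`. -/
noncomputable def closedLoopMap {ι 𝕜 : Type*} [Fintype ι] [RCLike 𝕜]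
    (A N G Q K₁ K₂ : Matrix ι ι 𝕜) :
    (ι → 𝕜) × (ι → 𝕜) × (ι → 𝕜) →L[𝕜] (ι → 𝕜) × (ι → 𝕜) × (ι → 𝕜) :=
  LinearMap.toContinuousLinearMap
    { toFun := fun z => (A *ᵥ z.1 - N *ᵥ (z.1 - z.2.1) - G *ᵥ z.2.2,
        -(K₁ *ᵥ (Q *ᵥ z.2.1 + Aᵀ *ᵥ z.2.2)), K₂ *ᵥ (A *ᵥ z.2.1 - G *ᵥ z.2.2))
      map_add' := fun a b => by
        simp only [Prod.fst_add, Prod.snd_add, mulVec_add, mulVec_sub, Prod.mk_add_mk]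
        refine Prod.ext ?_ (Prod.ext ?_ ?_) <;> simp only <;> abel
      map_smul' := fun c a => by
        simp only [Prod.smul_fst, Prod.smul_snd, ← smul_sub, ← smul_add, ← smul_neg, mulVec_smul,
          Prod.smul_mk, RingHom.id_apply] }

@[simp] theorem closedLoopMap_apply {ι 𝕜 : Type*} [Fintype ι] [RCLike 𝕜]
    (A N G Q K₁ K₂ : Matrix ι ι 𝕜) (z : (ι → 𝕜) × (ι → 𝕜) × (ι → 𝕜)) :
    closedLoopMap A N G Q K₁ K₂ z = (A *ᵥ z.1 - N *ᵥ (z.1 - z.2.1) - G *ᵥ z.2.2,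
      -(K₁ *ᵥ (Q *ᵥ z.2.1 + Aᵀ *ᵥ z.2.2)), K₂ *ᵥ (A *ᵥ z.2.1 - G *ᵥ z.2.2)) := rfl

variable {n m p : ℕ} {A : Matrix (Fin n) (Fin n) ℝ} {B : Matrix (Fin n) (Fin m) ℝ}
  {C : Matrix (Fin n) (Fin p) ℝ} {d : Fin p → ℝ} {Q : Matrix (Fin n) (Fin n) ℝ}
  {R : Matrix (Fin m) (Fin m) ℝ} {Ky Kl P : Matrix (Fin n) (Fin n) ℝ}

/-- The equations for `(y, l)` do not involve `x` and have matrix `S`. An eigenvector with `0 ≤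
μ.re` therefore has `y = l = 0`, and its `x` part is an eigenvector of `A - B K`. -/
theorem stableSubspace_closedLoopMap_eq_top (hQ : Q.PosSemidef) (hR : R.PosDef)
    (hdet : IsDetectable A Q) (hS : IsHurwitz (primalDualMatrix A B Q R Ky Kl))
    (hP : IsRiccatiSolution A B Q R P) :
    stableSubspace (closedLoopMap A (B * feedbackGain B R P) (B * R⁻¹ * Bᵀ) Q Ky Kl) = ⊤ := by
  refine stableSubspace_eq_top_of_complexification
    (ι := (vecOfReal (Fin n)).prodMap ((vecOfReal (Fin n)).prodMap (vecOfReal (Fin n))))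
    (ρ := (vecRe (Fin n)).prodMap ((vecRe (Fin n)).prodMap (vecRe (Fin n))))
    (T := closedLoopMap A.complexify (B * feedbackGain B R P).complexify
      (B * R⁻¹ * Bᵀ).complexify Q.complexify Ky.complexify Kl.complexify)
    (fun _ => Prod.ext (vecRe_vecOfReal _) (Prod.ext (vecRe_vecOfReal _) (vecRe_vecOfReal _)))
    (fun v => ?_) ?_
  · simp [vecRe_mulVec, ← complexify_transpose]
  · rintro μ ⟨x, y, l⟩ hμ hv
    rw [closedLoopMap_apply, Prod.smul_mk, Prod.smul_mk, Prod.mk.injEq, Prod.mk.injEq] at hv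
    obtain ⟨h1, h2, h3⟩ := hv
    simp only [← complexify_transpose] at h1 h2 h3
    have h := hS.eq_zero_of_mulVec_eq_smul hμ (w := Sum.elim y l) (by
      rw [primalDualMatrix_complexify_mulVec, h2, h3]
      ext (i | i) <;> rfl)
    obtain rfl : y = 0 := funext fun i => congrFun h (Sum.inl i)
    obtain rfl : l = 0 := funext fun i => congrFun h (Sum.inr i)
    have hx : x = 0 := by
      refine hP.eq_zero_of_mulVec_eq_smul hQ hR hdet hμ ?_
      rw [mulVec_zero, sub_zero, sub_zero, ← sub_mulVec] at h1
      rw [← h1]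
      congr 1
      ext; simp
    rw [hx]; rfl

/-- The KKT conditions express `C d` as `B R⁻¹ Bᵀ lbar - A xbar`, which absorbs the affine term into
the shift of the origin. -/
theorem closedLoop_eq (hR : R.PosDef) (K : Matrix (Fin m) (Fin n) ℝ) {xbar lbar : Fin n → ℝ}
    {ubar : Fin m → ℝ} (h : IsMultiplier A B C Q R d xbar ubar lbar)
    (z : (Fin n → ℝ) × (Fin n → ℝ) × (Fin n → ℝ)) :
    closedLoop A B C Q R Ky Kl K d z =
      closedLoopMap A (B * K) (B * R⁻¹ * Bᵀ) Q Ky Kl (z - (xbar, xbar, lbar)) := by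
  obtain ⟨x, y, l⟩ := z
  have hu := eq_neg_mulVec_of_isMultiplier hR h
  obtain ⟨h1, -, h3⟩ := h
  have hC : C *ᵥ d = (B * R⁻¹ * Bᵀ) *ᵥ lbar - A *ᵥ xbar := by
    rw [plant, hu, mulVec_neg, mulVec_mulVec, ← Matrix.mul_assoc] at h3
    rw [eq_neg_of_add_eq_zero_right h3]
    abel
  rw [closedLoopMap_apply]
  simp only [closedLoop, plant, nearOptimalInput, hC, Prod.mk_sub_mk]
  refine Prod.ext ?_ (Prod.ext ?_ ?_) <;> simp only
  · simp only [mulVec_sub, mulVec_neg, ← mulVec_mulVec]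
    abel
  · rw [mulVec_sub, mulVec_sub, sub_add_sub_comm, h1, sub_zero]
  · rw [mulVec_sub A, mulVec_sub (B * R⁻¹ * Bᵀ)]
    congr 1
    abel

/-- The change of coordinates `(x, y, l) ↦ (x, y, l - K x)`. -/
noncomputable def multiplierShift (K : Matrix (Fin n) (Fin n) ℝ) :
    ((Fin n → ℝ) × (Fin n → ℝ) × (Fin n → ℝ)) ≃L[ℝ]
      ((Fin n → ℝ) × (Fin n → ℝ) × (Fin n → ℝ)) :=
  LinearEquiv.toContinuousLinearEquiv
    { toFun := fun z => (z.1, z.2.1, z.2.2 - K *ᵥ z.1)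
      invFun := fun z => (z.1, z.2.1, z.2.2 + K *ᵥ z.1)
      left_inv := fun z => by simp
      right_inv := fun z => by simp
      map_add' := fun a b => by
        simp only [Prod.fst_add, Prod.snd_add, mulVec_add, Prod.mk_add_mk, add_sub_add_comm]
      map_smul' := fun c a => by
        simp only [Prod.smul_fst, Prod.smul_snd, mulVec_smul, Prod.smul_mk, smul_sub,
          RingHom.id_apply] }

theorem multiplierShift_apply (K : Matrix (Fin n) (Fin n) ℝ)
    (z : (Fin n → ℝ) × (Fin n → ℝ) × (Fin n → ℝ)) :
    multiplierShift K z = (z.1, z.2.1, z.2.2 - K *ᵥ z.1) := rfl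

/-- In the derivative of `l - Kl x`, the terms `Kl C d` and `Kl B R⁻¹ Bᵀ l` occur in both parts and
cancel, leaving `-Kl (A - B K) (x - y)`. -/
theorem implementableClosedLoop_multiplierShift (K : Matrix (Fin m) (Fin n) ℝ)
    (z : (Fin n → ℝ) × (Fin n → ℝ) × (Fin n → ℝ)) :
    implementableClosedLoop A B C Q R Ky Kl K d (multiplierShift Kl z) =
      multiplierShift Kl (closedLoop A B C Q R Ky Kl K d z) := by
  obtain ⟨x, y, l⟩ := z
  rw [multiplierShift_apply, multiplierShift_apply]
  simp only [implementableClosedLoop, implementableController, closedLoop, sub_add_cancel]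
  refine Prod.ext rfl (Prod.ext rfl ?_)
  simp only [plant, nearOptimalInput]
  rw [← mulVec_sub, ← mulVec_neg]
  congr 1
  simp only [sub_mulVec, mulVec_sub, mulVec_neg, ← mulVec_mulVec]
  abel

end ClosedLoop

theorem mainTheorem2 {n m p : ℕ}
    (A : Matrix (Fin n) (Fin n) ℝ) (B : Matrix (Fin n) (Fin m) ℝ) (C : Matrix (Fin n) (Fin p) ℝ)
    (Q : Matrix (Fin n) (Fin n) ℝ) (R : Matrix (Fin m) (Fin m) ℝ)
    (Ky Kl : Matrix (Fin n) (Fin n) ℝ) (d : Fin p → ℝ)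
    (hQ : Q.PosSemidef) (hR : R.PosDef) (hKy : Ky.PosDef) (hKl : Kl.PosDef)
    (hstab : IsStabilizable A B) (hdet : IsDetectable A Q)
    (hS : IsHurwitz (primalDualMatrix A B Q R Ky Kl)) :
    (∃! P : Matrix (Fin n) (Fin n) ℝ, IsRiccatiSolution A B Q R P) ∧
    (∃! w : (Fin n → ℝ) × (Fin m → ℝ), IsOptimalSteadyState A B C Q R d w) ∧
    ∀ (P : Matrix (Fin n) (Fin n) ℝ) (xbar : Fin n → ℝ) (ubar : Fin m → ℝ),
      IsRiccatiSolution A B Q R P → IsOptimalSteadyState A B C Q R d (xbar, ubar) →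
      (∃! l : Fin n → ℝ, IsMultiplier A B C Q R d xbar ubar l) ∧
      ∀ lbar : Fin n → ℝ, IsMultiplier A B C Q R d xbar ubar lbar →
        -- the closed loop in the variables `(x, y, λ)`
        IsAsymptoticallyStable (closedLoop A B C Q R Ky Kl (feedbackGain B R P) d)
          (xbar, xbar, lbar) ∧
        (∀ z, closedLoop A B C Q R Ky Kl (feedbackGain B R P) d z = 0 ↔ z = (xbar, xbar, lbar)) ∧
        nearOptimalInput B R (feedbackGain B R P) xbar xbar lbar = ubar ∧
        -- its disturbance-independent realization in the variables `(x, y, μ)`, `μ = λ - K^λ x`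
        IsAsymptoticallyStable (implementableClosedLoop A B C Q R Ky Kl (feedbackGain B R P) d)
          (xbar, xbar, lbar - Kl *ᵥ xbar) ∧
        (∀ z, implementableClosedLoop A B C Q R Ky Kl (feedbackGain B R P) d z = 0 ↔
          z = (xbar, xbar, lbar - Kl *ᵥ xbar)) := by
  refine ⟨existsUnique_isRiccatiSolution hQ hR hstab hdet,
    existsUnique_isOptimalSteadyState hQ hR hS, fun P xbar ubar hP hopt =>
    ⟨existsUnique_isMultiplier hQ hR hS hopt, fun lbar hl => ?_⟩⟩
  have h1 : IsAsymptoticallyStable (closedLoop A B C Q R Ky Kl (feedbackGain B R P) d)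
      (xbar, xbar, lbar) :=
    isAsymptoticallyStable_of_stableSubspace_eq_top
      (stableSubspace_closedLoopMap_eq_top hQ hR hdet hS hP) (closedLoop_eq hR _ hl)
  have h2 : IsAsymptoticallyStable (implementableClosedLoop A B C Q R Ky Kl (feedbackGain B R P) d)
      (xbar, xbar, lbar - Kl *ᵥ xbar) :=
    h1.conj (multiplierShift Kl) (implementableClosedLoop_multiplierShift _)
  refine ⟨h1, fun z => ⟨h1.eq_of_apply_eq_zero, fun hz => hz ▸ h1.equilibrium⟩, ?_, h2,
    fun z => ⟨h2.eq_of_apply_eq_zero, fun hz => hz ▸ h2.equilibrium⟩⟩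
  rw [eq_neg_mulVec_of_isMultiplier hR hl, nearOptimalInput, sub_self, mulVec_zero, neg_zero,
    zero_sub]
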